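/- **Setting.** Let $\mathcal T$ be a countable partially ordered set. A *cut* is a subset $\mathcal C\subseteq\mathcal T$ that contains every $p\le t$ for each $t\in\mathcal C$; it is *bounded* if $\mathcal C\subseteq\{p: p\le t\}$ for some $t\in\mathcal T$. For $\mathcal P\subseteq\mathcal T$ and a wire $A$ of finite dimension $d_A\ge 0$, let $\mathcal F_A^{\mathcal P}$ be the bosonic Fock space over $\ell^2(\mathcal P)\otimes\mathbb C^{d_A}$, with vacuum $|\Omega\rangle$. For disjoint $\mathcal P,\mathcal P'$ identify $\mathcal F_A^{\mathcal P\cup\mathcal P'}=\mathcal F_A^{\mathcal P}\otimes\mathcal F_A^{\mathcal P'}$, let $\mathrm{tr}_{\mathcal P'}$ be the partial trace over $\mathcal F_A^{\mathcal P'}$, and embed $\mathcal F_A^{\mathcal P}$ as $\mathcal F_A^{\mathcal P}\otimes|\Omega\rangle$. Write $\mathfrak T(\mathcal H)$ for the trace class operators on $\mathcal H$. A *causality function* is a map $\chi$ from cuts to cuts such that $\chi(\mathcal C\cup\mathcal D)=\chi(\mathcal C)\cup\chi(\mathcal D)$; $\mathcal C\subseteq\mathcal D$ implies $\chi(\mathcal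 C)\subseteq\chi(\mathcal D)$; $\chi(\mathcal C)\subsetneq\mathcal C$ for every nonempty bounded cut; and for every bounded cut $\mathcal C$ and $t\in\mathcal C$ there is $n$ with $t\notin\chi^n(\mathcal C)$. A family $\Phi=\{\Phi^{\mathcal C}:\mathfrak T(\mathcal F_X^{\mathcal T})\to\mathfrak T(\mathcal F_Y^{\mathcal C})\}$ of linear maps, indexed by the bounded cuts, *respects* $\chi$ if $\Phi^{\mathcal C}=\Phi^{\mathcal C}\circ\mathrm{tr}_{\mathcal T\setminus\chi(\mathcal C)}$ for all bounded $\mathcal C$. It is a *causal box* if all $\Phi^{\mathcal C}$ are completely positive and trace preserving, $\Phi^{\mathcal C}=\mathrm{tr}_{\mathcal D\setminus\mathcal C}\circ\Phi^{\mathcal D}$ for bounded cuts $\mathcal C\subseteq\mathcal D$, and $\Phi$ respects some causality function. It is a *subnormalized causal box* if all $\Phi^{\mathcal C}$ are completely positive and there are a further wire $R$ of finite dimension and a causal box $\hat\Phi$ with output wire $RY$ such that $\Phi^{\mathcal C}(\rho)=(\langle\Omega|_R\otimes I_Y)\,\hat\Phi^{\mathcal C}(\rho)\,(|\Omega\rangle_R\otimes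 I_Y)$ for all bounded $\mathcal C$. A *minimal Stinespring representation* of a map $\Psi:\mathfrak T(\mathcal H)\to\mathfrak T(\mathcal K)$ is a bounded operator $U:\mathcal H\to\mathcal K\otimes\mathcal H_Q$ with $\Psi(\rho)=\mathrm{tr}_Q(U\rho U^\dagger)$ such that the vectors $(A\otimes I_Q)Ux$, with $A$ a bounded operator on $\mathcal K$ and $x\in\mathcal H$, span a dense subspace of $\mathcal K\otimes\mathcal H_Q$. Suppose $\Phi$ respects the causality function $\chi$. A *sequence representation* of $\Phi^{\mathcal C}$ consists of cuts $\mathcal C=\mathcal C_1\supseteq\mathcal C_2\supseteq\cdots$ with $\chi(\mathcal C_i)=\mathcal C_{i+1}$ and $\bigcap_i\mathcal C_i=\emptyset$, minimal Stinespring representations $U^{\mathcal C_i}:\mathcal F_X^{\mathcal C_{i+1}}\to\mathcal F_Y^{\mathcal C_i}\otimes\mathcal H_{Q_i}$ of the restrictions $\Phi^{\mathcal C_i}:\mathfrak T(\mathcal F_X^{\chi(\mathcal C_i)})\to\mathfrak T(\mathcal F_Y^{\mathcal C_i})$, and, with $\mathcal T_i=\mathcal C_i\setminus\mathcal C_{i+1}$,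 bounded operators $V_i:\mathcal H_{Q_{i+1}}\otimes\mathcal F_X^{\mathcal T_{i+1}}\to\mathcal F_Y^{\mathcal T_i}\otimes\mathcal H_{Q_i}$ such that for all $n\ge2$ $$U^{\mathcal C_1}=\Big(\prod_{i=1}^{n-1} I_Y^{\mathcal C_{i+1}}\otimes V_i\otimes I_X^{\mathcal C_2\setminus\mathcal C_{i+1}}\Big)\Big(U^{\mathcal C_n}\otimes I_X^{\mathcal C_2\setminus\mathcal C_{n+1}}\Big),$$ the factors of the product being ordered with $i=1$ leftmost. **Proposition.** Let $\Phi$ be a causal box, $\chi$ any causality function that $\Phi$ respects, and $\mathcal C$ a bounded cut. Put $\mathcal C_i=\chi^{i-1}(\mathcal C)$. Then for every $i$ the sets $\mathcal T_{i+1}$ and $\mathcal T_i$ of input and output positions of $V_i$ are disjoint, each $\Phi^{\mathcal C_i}:\mathfrak T(\mathcal F_X^{\mathcal C_{i+1}})\to\mathfrak T(\mathcal F_Y^{\mathcal C_i})$ has a minimal Stinespring representation, and for every choice $(U^{\mathcal C_i})_i$ of such representations there are isometries $V_i$ that form with them a sequence representation of $\Phi^{\mathcal C}$ along the cuts $\mathcal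 C_i$. **Corollary.** Every subnormalized causal box $\Phi$ respects some causality function, and for each causality function $\chi$ that it respects and each bounded cut $\mathcal C$ the same holds, with operators $V_i$ of norm at most $1$ in place of isometries. In particular $\Phi^{\mathcal C}$ has a sequence representation. -/

import Mathlib

universe u

noncomputable section

namespace CausalBoxes

open scoped ComplexOrder InnerProductSpace

/-! ## Hilbert spaces and trace class operators

Every Hilbert space below is `ℓ²(ι)` for a set `ι` labelling an orthonormal basis, and the Hilbert
space tensor product `ℓ²(α) ⊗ ℓ²(β)` is `ℓ²(α × β)`, with `|a⟩ ⊗ |b⟩ = |(a, b)⟩`. -/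

/-- The Hilbert space `ℓ²(ι)` with orthonormal basis `|i⟩`, `i : ι`. -/
abbrev L2 (ι : Type u) : Type u := lp (fun _ : ι => ℂ) 2

open Classical in
/-- The basis vector `|i⟩`. -/
def ket {ι : Type u} (i : ι) : L2 ι := lp.single 2 i (1 : ℂ)

/-- The operator `|A| = √(A† A)`. -/
def absOp {H : Type u} [NormedAddCommGroup H] [InnerProductSpace ℂ H] [CompleteSpace H]
    (A : H →L[ℂ] H) : H →L[ℂ] H := CFC.abs A

/-- `A` is trace class if `∑ᵢ ⟨i| √(A† A) |i⟩ < ∞`. -/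
def IsTraceClass {ι : Type u} (A : L2 ι →L[ℂ] L2 ι) : Prop :=
  Summable fun i => (⟪ket i, absOp A (ket i)⟫_ℂ).re

section Nuclear

/-- Auxiliary: `A = ∑ₖ |xₖ⟩⟨yₖ|` with `∑ₖ ‖xₖ‖ ‖yₖ‖ < ∞`. This is proved equivalent to being
trace class and used to show that the trace class operators form a vector space on which
conjugations and partial traces act. -/
def IsNuclear {ι : Type u} (A : L2 ι →L[ℂ] L2 ι) : Prop :=
  ∃ (κ : Type u) (x y : κ → L2 ι), Summable (fun k => ‖x k‖ * ‖y k‖) ∧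
    ∀ z, HasSum (fun k => ⟪y k, z⟫_ℂ • x k) (A z)

theorem exists_factor {E F G : Type u} [NormedAddCommGroup E] [InnerProductSpace ℂ E]
    [NormedAddCommGroup F] [InnerProductSpace ℂ F] [CompleteSpace F]
    [NormedAddCommGroup G] [InnerProductSpace ℂ G] [CompleteSpace G]
    (A : E →L[ℂ] F) (B : E →L[ℂ] G) (h : ∀ x, ‖A x‖ ≤ ‖B x‖) :
    ∃ W : G →L[ℂ] F, ∀ x, A x = W (B x) := by
  let M : Submodule ℂ G := (LinearMap.range B.toLinearMap).topologicalClosure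
  have hM : ∀ x, B x ∈ M := fun x =>
    Submodule.le_topologicalClosure _ (LinearMap.mem_range_self B.toLinearMap x)
  let e : E →ₗ[ℂ] M := B.toLinearMap.codRestrict M hM
  have : CompleteSpace M := (Submodule.isClosed_topologicalClosure _).completeSpace_coe
  have hd : DenseRange e := by
    intro y
    rw [Metric.mem_closure_iff]
    intro ε hε
    have hy : (y : G) ∈ closure (LinearMap.range B.toLinearMap : Set G) := y.2
    obtain ⟨_, ⟨x, rfl⟩, hx⟩ := Metric.mem_closure_iff.1 hy ε hε
    exact ⟨e x, ⟨x, rfl⟩, hx⟩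
  have hn : ∃ C : ℝ, ∀ x, ‖A.toLinearMap x‖ ≤ C * ‖e x‖ := ⟨1, fun x => by
    rw [one_mul]; exact h x⟩
  refine ⟨(A.toLinearMap.extendOfNorm e).comp M.orthogonalProjectionOnto, fun x => ?_⟩
  have h1 : M.orthogonalProjectionOnto (B x) = e x :=
    Submodule.orthogonalProjectionOnto_mem_subspace_eq_self (e x)
  rw [ContinuousLinearMap.comp_apply, h1, LinearMap.extendOfNorm_eq hd hn]
  rfl

theorem norm_absOp_apply {H : Type u} [NormedAddCommGroup H] [InnerProductSpace ℂ H]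
    [CompleteSpace H] (A : H →L[ℂ] H) (x : H) : ‖absOp A x‖ = ‖A x‖ := by
  have hs : star (CFC.abs A) = CFC.abs A := (CFC.abs_nonneg A).isSelfAdjoint
  have h : ⟪absOp A x, absOp A x⟫_ℂ = ⟪A x, A x⟫_ℂ := by
    unfold absOp
    rw [← ContinuousLinearMap.adjoint_inner_right, ← ContinuousLinearMap.adjoint_inner_right,
      ← ContinuousLinearMap.star_eq_adjoint, ← ContinuousLinearMap.star_eq_adjoint, hs,
      ← mul_apply_eq_comp, ← mul_apply_eq_comp, CFC.abs_mul_abs]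
  have h2 : ‖absOp A x‖ ^ 2 = ‖A x‖ ^ 2 := by
    rw [← inner_self_eq_norm_sq (𝕜 := ℂ), ← inner_self_eq_norm_sq (𝕜 := ℂ), h]
  exact (sq_eq_sq₀ (norm_nonneg _) (norm_nonneg _)).1 h2

theorem exists_sqrt_absOp {H : Type u} [NormedAddCommGroup H] [InnerProductSpace ℂ H]
    [CompleteSpace H] (A : H →L[ℂ] H) :
    ∃ S : H →L[ℂ] H, (∀ x, S (S x) = absOp A x) ∧ ∀ x y, ⟪S x, y⟫_ℂ = ⟪x, S y⟫_ℂ := by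
  have hsa : ContinuousLinearMap.adjoint (CFC.sqrt (CFC.abs A)) = CFC.sqrt (CFC.abs A) := by
    rw [← ContinuousLinearMap.star_eq_adjoint]
    exact (CFC.sqrt_nonneg (CFC.abs A)).isSelfAdjoint
  refine ⟨CFC.sqrt (CFC.abs A), fun x => ?_, fun x y => ?_⟩
  · rw [← mul_apply_eq_comp, CFC.sqrt_mul_sqrt_self _ (CFC.abs_nonneg A)]; rfl
  · rw [← ContinuousLinearMap.adjoint_inner_right, hsa]

theorem inner_ket {ι : Type u} (i : ι) (f : L2 ι) : ⟪ket i, f⟫_ℂ = f i := by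
  classical
  rw [ket, lp.inner_single_left]
  simp

theorem hasSum_ket {ι : Type u} (f : L2 ι) : HasSum (fun i => ⟪ket i, f⟫_ℂ • ket i) f := by
  classical
  have := lp.hasSum_single (p := 2) (by norm_num) f
  convert this using 2 with i
  rw [inner_ket, ket, ← lp.single_smul]
  simp

theorem hasSum_norm_sq {ι : Type u} (f : L2 ι) : HasSum (fun i => ‖f i‖ ^ 2) (‖f‖ ^ 2) := by
  have := lp.hasSum_norm (p := 2) (by norm_num) f
  simpa using this

theorem ket_apply {ι : Type u} (i j : ι) [Decidable (j = i)] :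
    ket i j = if j = i then (1 : ℂ) else 0 := by
  classical
  split_ifs with h
  · subst h; exact lp.single_apply_self _ _ _
  · exact lp.single_apply_ne _ _ _ h

theorem summable_mul_le {κ : Type u} {a b : κ → ℝ} {p q : ℝ} (ha : ∀ k, 0 ≤ a k)
    (hb : ∀ k, 0 ≤ b k) (hp : 0 ≤ p) (hq : 0 ≤ q) (h1 : HasSum (fun k => a k ^ 2) (p ^ 2))
    (h2 : HasSum (fun k => b k ^ 2) (q ^ 2)) :
    Summable (fun k => a k * b k) ∧ ∑' k, a k * b k ≤ p * q := by
  have key : ∀ s : Finset κ, ∑ k ∈ s, a k * b k ≤ p * q := fun s => by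
    have h := Finset.sum_mul_sq_le_sq_mul_sq s a b
    have h3 : ∑ k ∈ s, a k ^ 2 ≤ p ^ 2 := sum_le_hasSum s (fun _ _ => sq_nonneg _) h1
    have h4 : ∑ k ∈ s, b k ^ 2 ≤ q ^ 2 := sum_le_hasSum s (fun _ _ => sq_nonneg _) h2
    refine le_of_sq_le_sq ?_ (mul_nonneg hp hq)
    rw [mul_pow]
    exact h.trans (mul_le_mul h3 h4 (Finset.sum_nonneg fun _ _ => sq_nonneg _) (sq_nonneg _))
  have hs := summable_of_sum_le (fun k => mul_nonneg (ha k) (hb k)) key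
  exact ⟨hs, hs.tsum_le_of_sum_le key⟩

theorem isTraceClass_iff_isNuclear {ι : Type u} (A : L2 ι →L[ℂ] L2 ι) :
    IsTraceClass A ↔ IsNuclear A := by
  constructor
  · intro h
    obtain ⟨W, hW⟩ := exists_factor A (absOp A) (fun x => (norm_absOp_apply A x).ge)
    obtain ⟨S, hS, hsa⟩ := exists_sqrt_absOp A
    have hn : ∀ i, ‖S (ket i)‖ ^ 2 = (⟪ket i, absOp A (ket i)⟫_ℂ).re := fun i => by
      rw [← hS, ← hsa]
      exact (inner_self_eq_norm_sq (𝕜 := ℂ) _).symm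
    refine ⟨ι, fun i => W (S (ket i)), fun i => S (ket i), ?_, fun z => ?_⟩
    · refine Summable.of_nonneg_of_le (fun i => by positivity) (fun i => ?_) (h.mul_left ‖W‖)
      calc ‖W (S (ket i))‖ * ‖S (ket i)‖ ≤ (‖W‖ * ‖S (ket i)‖) * ‖S (ket i)‖ := by
            gcongr; exact W.le_opNorm _
        _ = _ := by rw [mul_assoc, ← sq, hn]
    · have h1 := (hasSum_ket (S z)).mapL (W.comp S)
      rw [ContinuousLinearMap.comp_apply, hS, ← hW] at h1
      convert h1 using 2 with i
      rw [map_smul, ContinuousLinearMap.comp_apply, hsa]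
  · rintro ⟨κ, x, y, hs, hA⟩
    obtain ⟨Z, hZ⟩ := exists_factor (absOp A) A (fun x => (norm_absOp_apply A x).le)
    have hs' : Summable (fun k => ‖Z (x k)‖ * ‖y k‖) := by
      refine Summable.of_nonneg_of_le (fun i => by positivity) (fun i => ?_) (hs.mul_left ‖Z‖)
      rw [← mul_assoc]; gcongr; exact Z.le_opNorm _
    have h2 : Summable fun p : κ × ι => ‖(Z (x p.1)) p.2‖ * ‖(y p.1) p.2‖ := by
      have hk := fun k => summable_mul_le (fun i => norm_nonneg _) (fun i => norm_nonneg _)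
        (norm_nonneg _) (norm_nonneg _) (hasSum_norm_sq (Z (x k))) (hasSum_norm_sq (y k))
      rw [summable_prod_of_nonneg (fun p => by positivity)]
      exact ⟨fun k => (hk k).1, Summable.of_nonneg_of_le
        (fun k => tsum_nonneg fun i => by positivity) (fun k => (hk k).2) hs'⟩
    have h3 := (summable_prod_of_nonneg (fun p => by positivity)).1 h2.prod_symm
    refine Summable.of_norm_bounded h3.2 (fun i => ?_)
    have h4 : HasSum (fun k => ⟪y k, ket i⟫_ℂ * (Z (x k)) i) ⟪ket i, absOp A (ket i)⟫_ℂ := by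
      have := ((hA (ket i)).mapL Z).mapL (innerSL ℂ (ket i))
      simpa [hZ, inner_smul_right, inner_ket] using this
    have h5 : ∀ k, ‖⟪y k, ket i⟫_ℂ * (Z (x k)) i‖ = ‖(Z (x k)) i‖ * ‖(y k) i‖ := fun k => by
      rw [norm_mul, norm_inner_symm, inner_ket, mul_comm]
    calc ‖(⟪ket i, absOp A (ket i)⟫_ℂ).re‖ ≤ ‖⟪ket i, absOp A (ket i)⟫_ℂ‖ :=
          Complex.abs_re_le_norm _
      _ ≤ ∑' k, ‖⟪y k, ket i⟫_ℂ * (Z (x k)) i‖ := by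
          rw [← h4.tsum_eq]
          refine norm_tsum_le_tsum_norm ?_
          simp_rw [h5]; exact h3.1 i
      _ = _ := by simp_rw [h5]; rfl

end Nuclear

/-- The vector space of trace class operators on `ℓ²(ι)`. -/
def TC (ι : Type u) : Submodule ℂ (L2 ι →L[ℂ] L2 ι) where
  carrier := {A | IsTraceClass A}
  zero_mem' := (isTraceClass_iff_isNuclear _).2
    ⟨PEmpty, fun _ => 0, fun _ => 0, summable_empty, fun z => by simp⟩
  add_mem' := by
    intro A B hA hB
    obtain ⟨κ, x, y, hs, h⟩ := (isTraceClass_iff_isNuclear _).1 hA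
    obtain ⟨κ', x', y', hs', h'⟩ := (isTraceClass_iff_isNuclear _).1 hB
    refine (isTraceClass_iff_isNuclear _).2 ⟨κ ⊕ κ', Sum.elim x x', Sum.elim y y', ?_, fun z => ?_⟩
    · exact Summable.sum _ hs hs'
    · exact HasSum.sum (f := fun k => ⟪Sum.elim y y' k, z⟫_ℂ • Sum.elim x x' k) (h z) (h' z)
  smul_mem' := by
    intro c A hA
    obtain ⟨κ, x, y, hs, h⟩ := (isTraceClass_iff_isNuclear _).1 hA
    refine (isTraceClass_iff_isNuclear _).2 ⟨κ, fun k => c • x k, y, ?_, fun z => ?_⟩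
    · simpa [norm_smul, mul_assoc] using hs.mul_left ‖c‖
    · simpa [smul_comm c] using (h z).const_smul c

/-- The trace `∑ᵢ ⟨i|ρ|i⟩`. -/
def tr {ι : Type u} (ρ : TC ι) : ℂ := ∑' i, ⟪ket i, ρ.1 (ket i)⟫_ℂ

/-- Conjugation `ρ ↦ V ρ V†`. -/
def conj {α β : Type u} (V : L2 α →L[ℂ] L2 β) : TC α →ₗ[ℂ] TC β where
  toFun ρ := ⟨V ∘L ρ.1 ∘L ContinuousLinearMap.adjoint V, by
    obtain ⟨κ, x, y, hs, h⟩ := (isTraceClass_iff_isNuclear _).1 ρ.2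
    refine (isTraceClass_iff_isNuclear _).2 ⟨κ, fun k => V (x k), fun k => V (y k), ?_, fun z => ?_⟩
    · refine Summable.of_nonneg_of_le (fun i => by positivity) (fun i => ?_)
        (hs.mul_left (‖V‖ * ‖V‖))
      calc ‖V (x i)‖ * ‖V (y i)‖ ≤ (‖V‖ * ‖x i‖) * (‖V‖ * ‖y i‖) := by
            gcongr <;> exact V.le_opNorm _
        _ = _ := by ring
    · have h1 := (h (ContinuousLinearMap.adjoint V z)).mapL V
      simpa [ContinuousLinearMap.adjoint_inner_right] using h1⟩
  map_add' ρ σ := by ext1; simp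
  map_smul' c ρ := by ext1; simp

theorem summable_comp_sq {α β : Type u} (j : α ↪ β) (f : L2 β) :
    Summable fun a => ‖f (j a)‖ ^ 2 :=
  (hasSum_norm_sq f).summable.comp_injective j.injective

theorem memℓp_of_sq {α : Type u} {f : α → ℂ} (h : Summable fun a => ‖f a‖ ^ 2) :
    Memℓp (E := fun _ : α => ℂ) f 2 := memℓp_gen (by simpa using h)

/-- For an injection `j` of basis labels, the operator `f ↦ f ∘ j`, that is
`|j a⟩ ↦ |a⟩`, and `|b⟩ ↦ 0` for `b` outside the range of `j`. -/
def res {α β : Type u} (j : α ↪ β) : L2 β →L[ℂ] L2 α :=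
  LinearMap.mkContinuous
    { toFun := fun f => ⟨fun a => f (j a), memℓp_of_sq (summable_comp_sq j f)⟩
      map_add' := fun f g => by ext a; rfl
      map_smul' := fun c f => by ext a; rfl }
    1 (fun f => by
      rw [one_mul]
      refine le_of_sq_le_sq ?_ (norm_nonneg _)
      rw [← (hasSum_norm_sq f).tsum_eq, ← (hasSum_norm_sq _).tsum_eq]
      exact tsum_comp_le_tsum_of_inj (hasSum_norm_sq f).summable (fun _ => sq_nonneg _) j.injective)

/-- The isometry `|a⟩ ↦ |j a⟩`, the adjoint of `res j`. -/
def ext {α β : Type u} (j : α ↪ β) : L2 α →L[ℂ] L2 β := ContinuousLinearMap.adjoint (res j)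

@[simp] theorem res_apply {α β : Type u} (j : α ↪ β) (f : L2 β) (a : α) : res j f a = f (j a) := rfl

/-- With `ℓ²(γ) ≅ ℓ²(α) ⊗ ℓ²(β)` through `e`, the map of labels `a ↦ e (a, b)`; thus
`res (slice e b) = I ⊗ ⟨b|` and `ext (slice e b) = I ⊗ |b⟩`. -/
def slice {α β γ : Type u} (e : α × β ≃ γ) (b : β) : α ↪ γ :=
  ⟨fun a => e (a, b), fun a a' h => by simpa using e.injective h⟩

theorem hasSum_slice {α β γ : Type u} (e : α × β ≃ γ) (f : L2 γ) :
    HasSum (fun b => ‖res (slice e b) f‖ ^ 2) (‖f‖ ^ 2) := by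
  have h := (e.hasSum_iff (f := fun c => ‖f c‖ ^ 2)).2 (hasSum_norm_sq f)
  have h' := ((Equiv.prodComm β α).hasSum_iff (f := _)).2 h
  exact h'.prod_fiberwise fun b => hasSum_norm_sq (res (slice e b) f)

theorem summable_slice {α β γ κ : Type u} (e : α × β ≃ γ) {x y : κ → L2 γ}
    (hs : Summable fun k => ‖x k‖ * ‖y k‖) :
    Summable fun p : κ × β => ‖res (slice e p.2) (x p.1)‖ * ‖res (slice e p.2) (y p.1)‖ := by
  have hk := fun k => summable_mul_le (fun b => norm_nonneg _) (fun b => norm_nonneg _)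
    (norm_nonneg _) (norm_nonneg _) (hasSum_slice e (x k)) (hasSum_slice e (y k))
  rw [summable_prod_of_nonneg (fun p => by positivity)]
  exact ⟨fun k => (hk k).1, Summable.of_nonneg_of_le
    (fun k => tsum_nonneg fun i => by positivity) (fun k => (hk k).2) hs⟩

/-- The operator `(I ⊗ ⟨b|) A (I ⊗ |b⟩)`. -/
def block {α β γ : Type u} (e : α × β ≃ γ) (A : L2 γ →L[ℂ] L2 γ) (b : β) : L2 α →L[ℂ] L2 α :=
  res (slice e b) ∘L A ∘L ext (slice e b)

theorem hasSum_block {α β γ κ : Type u} (e : α × β ≃ γ) {A : L2 γ →L[ℂ] L2 γ} {x y : κ → L2 γ}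
    (hA : ∀ z, HasSum (fun k => ⟪y k, z⟫_ℂ • x k) (A z)) (b : β) (z : L2 α) :
    HasSum (fun k => ⟪res (slice e b) (y k), z⟫_ℂ • res (slice e b) (x k)) (block e A b z) := by
  have := (hA (ext (slice e b) z)).mapL (res (slice e b))
  simpa [ext, ContinuousLinearMap.adjoint_inner_right, block] using this

theorem summable_block {α β γ : Type u} (e : α × β ≃ γ) {A : L2 γ →L[ℂ] L2 γ}
    (hA : IsTraceClass A) : Summable (block e A) := by
  obtain ⟨κ, x, y, hs, h⟩ := (isTraceClass_iff_isNuclear _).1 hA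
  have h3 := (summable_prod_of_nonneg (fun p => by positivity)).1 (summable_slice e hs).prod_symm
  refine Summable.of_norm_bounded h3.2 (fun b => ?_)
  refine ContinuousLinearMap.opNorm_le_bound _ (tsum_nonneg fun _ => by positivity) fun z => ?_
  rw [← tsum_mul_right]
  refine tsum_of_norm_bounded (f := fun k => ⟪res (slice e b) (y k), z⟫_ℂ • res (slice e b) (x k))
    ((h3.1 b).mul_right ‖z‖).hasSum (fun k => ?_) |> fun h' => ?_
  rotate_left
  · rw [norm_smul]
    calc _ ≤ (‖res (slice e b) (y k)‖ * ‖z‖) * ‖res (slice e b) (x k)‖ := by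
          gcongr; exact norm_inner_le_norm _ _
      _ = _ := by simp only [Prod.swap]; ring
  · rwa [(hasSum_block e h b z).tsum_eq] at h'

/-- The partial trace over the second factor of `ℓ²(γ) ≅ ℓ²(α) ⊗ ℓ²(β)`,
`ρ ↦ ∑_b (I ⊗ ⟨b|) ρ (I ⊗ |b⟩)` (a norm convergent sum, by `summable_block`). -/
def ptrace {α β γ : Type u} (e : α × β ≃ γ) : TC γ →ₗ[ℂ] TC α where
  toFun ρ := ⟨∑' b, block e ρ.1 b, by
    have hb := summable_block e ρ.2
    obtain ⟨κ, x, y, hs, h⟩ := (isTraceClass_iff_isNuclear _).1 ρ.2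
    refine (isTraceClass_iff_isNuclear _).2 ⟨κ × β, fun p => res (slice e p.2) (x p.1),
      fun p => res (slice e p.2) (y p.1), summable_slice e hs, fun z => ?_⟩
    have hsum : Summable fun p : κ × β =>
        ⟪res (slice e p.2) (y p.1), z⟫_ℂ • res (slice e p.2) (x p.1) := by
      refine Summable.of_norm_bounded ((summable_slice e hs).mul_right ‖z‖) fun p => ?_
      rw [norm_smul]
      calc _ ≤ (‖res (slice e p.2) (y p.1)‖ * ‖z‖) * ‖res (slice e p.2) (x p.1)‖ := by
            gcongr; exact norm_inner_le_norm _ _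
        _ = _ := by ring
    have h1 := hsum.prod_symm.hasSum.prod_fiberwise fun b => hasSum_block e h b z
    have h2 : HasSum (fun b => block e ρ.1 b z) ((∑' b, block e ρ.1 b) z) :=
      hb.hasSum.mapL (ContinuousLinearMap.apply ℂ _ z)
    rw [h2.unique h1, ← (Equiv.prodComm κ β).symm.hasSum_iff]
    exact hsum.prod_symm.hasSum⟩
  map_add' ρ σ := by
    ext1
    change ∑' b, block e (ρ.1 + σ.1) b = (∑' b, block e ρ.1 b) + ∑' b, block e σ.1 b
    rw [← (summable_block e ρ.2).tsum_add (summable_block e σ.2)]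
    exact tsum_congr fun b => by ext1 z; simp [block]
  map_smul' c ρ := by
    ext1
    change ∑' b, block e (c • ρ.1) b = c • ∑' b, block e ρ.1 b
    rw [← (summable_block e ρ.2).tsum_const_smul]
    exact tsum_congr fun b => by ext1 z; simp [block]

/-- The map of labels `b ↦ e (a, b)`, so that `res (sliceR e a) = ⟨a| ⊗ I`. -/
def sliceR {α β γ : Type u} (e : α × β ≃ γ) (a : α) : β ↪ γ :=
  ⟨fun b => e (a, b), fun b b' h => by simpa using e.injective h⟩

theorem hasSum_sliceR {α β γ : Type u} (e : α × β ≃ γ) (f : L2 γ) :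
    HasSum (fun a => ‖res (sliceR e a) f‖ ^ 2) (‖f‖ ^ 2) :=
  hasSum_slice ((Equiv.prodComm β α).trans e) f

/-- The coordinates of `(I ⊗ V) f`: `⟨c, b| (I ⊗ V) f = ⟨b| V ((⟨c| ⊗ I) f)`. -/
def amplFun {α β γ α' : Type u} (e : γ × α ≃ α') (V : L2 α →L[ℂ] L2 β) (f : L2 α')
    (p : γ × β) : ℂ := V (res (sliceR e p.1) f) p.2

theorem hasSum_amplFun {α β γ α' : Type u} (e : γ × α ≃ α') (V : L2 α →L[ℂ] L2 β) (f : L2 α') :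
    Summable (fun p => ‖amplFun e V f p‖ ^ 2) ∧
      ∑' p, ‖amplFun e V f p‖ ^ 2 ≤ (‖V‖ * ‖f‖) ^ 2 := by
  have hs := hasSum_sliceR e f
  have hle : ∀ c, ‖V (res (sliceR e c) f)‖ ^ 2 ≤ ‖V‖ ^ 2 * ‖res (sliceR e c) f‖ ^ 2 := fun c => by
    rw [← mul_pow]; gcongr; exact V.le_opNorm _
  have h0 : Summable fun c => ‖V (res (sliceR e c) f)‖ ^ 2 :=
    Summable.of_nonneg_of_le (fun _ => sq_nonneg _) hle (hs.summable.mul_left (‖V‖ ^ 2))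
  have hf : ∀ c, HasSum (fun b => ‖amplFun e V f (c, b)‖ ^ 2) (‖V (res (sliceR e c) f)‖ ^ 2) :=
    fun c => hasSum_norm_sq (V (res (sliceR e c) f))
  have h1 : Summable fun p => ‖amplFun e V f p‖ ^ 2 := by
    refine (summable_prod_of_nonneg (f := fun p => ‖amplFun e V f p‖ ^ 2)
      (fun p => sq_nonneg _)).2 ?_
    exact ⟨fun c => (hf c).summable, h0.congr fun c => ((hf c).tsum_eq).symm⟩
  refine ⟨h1, ?_⟩
  rw [← (h1.hasSum.prod_fiberwise hf).tsum_eq, mul_pow, ← hs.tsum_eq, ← tsum_mul_left]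
  exact h0.tsum_le_tsum hle (hs.summable.mul_left _)

/-- The operator `I ⊗ V : ℓ²(γ) ⊗ ℓ²(α) → ℓ²(γ) ⊗ ℓ²(β)`, read through `e` and `e'`. -/
def ampl {α β γ α' β' : Type u} (e : γ × α ≃ α') (e' : γ × β ≃ β')
    (V : L2 α →L[ℂ] L2 β) : L2 α' →L[ℂ] L2 β' :=
  LinearMap.mkContinuous
    { toFun := fun f => ⟨fun b' => amplFun e V f (e'.symm b'), memℓp_of_sq
        ((hasSum_amplFun e V f).1.comp_injective e'.symm.injective)⟩
      map_add' := fun f g => by ext b; simp only [amplFun, map_add]; rfl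
      map_smul' := fun c f => by ext b; simp only [amplFun, map_smul]; rfl }
    ‖V‖ (fun f => by
      refine le_of_sq_le_sq ?_ (by positivity)
      rw [← (hasSum_norm_sq _).tsum_eq]
      exact (e'.symm.tsum_eq (fun p => ‖amplFun e V f p‖ ^ 2)).trans_le (hasSum_amplFun e V f).2)

/-! ## Wires

The single-message space `ℓ²(P) ⊗ ℂ^d` has the orthonormal basis `|v, t⟩`, `(v, t) : X × P`, with
`X` a set of `d` message values. The bosonic Fock space over it has the orthonormal basis of all
occupation states `|m⟩`, `m` a finite multiset of pairs `(v, t)`. The isomorphism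
`F(H ⊕ K) ≅ F(H) ⊗ F(K)` is `|m + m'⟩ ↔ |m⟩ ⊗ |m'⟩`. -/

/-! The next facts record that the occupation basis is the usual one. In the full Fock space
`⨁ₙ H^{⊗n} = ℓ²(lists over B)`, for `B` the labels of a basis of `H`, the bosonic Fock space consists
of the vectors invariant under permutations, and the states `|m⟩`, normalized sums over all distinct
orderings of `m`, form a complete orthonormal system of it. -/

open Classical in
/-- The distinct orderings of a multiset. -/
def orderings {B : Type u} (m : Multiset B) : Finset (List B) := m.toList.permutations.toFinset

theorem mem_orderings {B : Type u} {m : Multiset B} {l : List B} :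
    l ∈ orderings m ↔ (l : Multiset B) = m := by
  classical
  rw [orderings, List.mem_toFinset, List.mem_permutations, ← Multiset.coe_eq_coe,
    Multiset.coe_toList]

/-- The normalized symmetric state `|m⟩`. -/
def occVec {B : Type u} (m : Multiset B) : L2 (List B) :=
  ((√(orderings m).card : ℝ) : ℂ)⁻¹ • ∑ l ∈ orderings m, ket l

theorem inner_occVec {B : Type u} (m : Multiset B) (f : L2 (List B)) :
    ⟪occVec m, f⟫_ℂ = ((√(orderings m).card : ℝ) : ℂ)⁻¹ * ∑ l ∈ orderings m, f l := by
  rw [occVec, inner_smul_left, sum_inner]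
  simp [inner_ket]

open Classical in
theorem occVec_apply {B : Type u} (m : Multiset B) (l : List B) :
    occVec m l = if (l : Multiset B) = m then ((√(orderings m).card : ℝ) : ℂ)⁻¹ else 0 := by
  rw [← inner_ket, occVec, inner_smul_right, inner_sum]
  simp_rw [inner_ket, ket_apply]
  rw [Finset.sum_ite_eq]
  simp [mem_orderings]

theorem occVec_symmetric {B : Type u} (m : Multiset B) {l l' : List B} (h : l.Perm l') :
    occVec m l = occVec m l' := by
  rw [occVec_apply, occVec_apply, Multiset.coe_eq_coe.2 h]

theorem card_orderings_pos {B : Type u} (m : Multiset B) : 0 < (orderings m).card :=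
  Finset.card_pos.2 ⟨m.toList, mem_orderings.2 m.coe_toList⟩

theorem occVec_orthonormal {B : Type u} : Orthonormal ℂ (occVec (B := B)) := by
  classical
  rw [orthonormal_iff_ite]
  intro m m'
  rw [inner_occVec, Finset.sum_congr rfl fun l hl => by rw [occVec_apply, mem_orderings.1 hl]]
  split_ifs with h
  · subst h
    have h0 : (0 : ℝ) < (orderings m).card := by exact_mod_cast card_orderings_pos m
    have h1 : ((√(orderings m).card : ℝ) : ℂ) ≠ 0 := by
      exact_mod_cast (Real.sqrt_pos.2 h0).ne'
    rw [Finset.sum_const, nsmul_eq_mul]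
    field_simp
    rw [← Complex.ofReal_pow, Real.sq_sqrt h0.le]
    simp
  · simp

theorem occVec_complete {B : Type u} (f : L2 (List B)) (hf : ∀ l l', l.Perm l' → f l = f l')
    (h : ∀ m, ⟪occVec m, f⟫_ℂ = 0) : f = 0 := by
  ext l
  have h1 := h l
  have h0 : (0 : ℝ) < (orderings (l : Multiset B)).card := by
    exact_mod_cast card_orderings_pos (l : Multiset B)
  have h2 : ((√(orderings (l : Multiset B)).card : ℝ) : ℂ) ≠ 0 := by
    exact_mod_cast (Real.sqrt_pos.2 h0).ne'
  rw [inner_occVec, Finset.sum_congr rfl fun l' hl' =>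
    hf l' l (Multiset.coe_eq_coe.1 (mem_orderings.1 hl')), Finset.sum_const, nsmul_eq_mul] at h1
  have h3 : ((orderings (l : Multiset B)).card : ℂ) ≠ 0 := by exact_mod_cast h0.ne'
  simpa [h2, h3] using h1

/-- The labels of the occupation basis: finite multisets of messages at positions in `P`. -/
def Occ (X : Type) {T : Type u} (P : Set T) : Type u :=
  {m : Multiset (X × T) // ∀ p ∈ m, p.2 ∈ P}

namespace Occ

variable {X : Type} {T : Type u} {P P' D : Set T}

/-- The label of the vacuum state `|Ω⟩`. -/
def vac : Occ X P := ⟨0, by simp⟩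

/-- `|m⟩ ↦ |m⟩ ⊗ |Ω⟩`, the embedding of the space on `P` into the space on `D`. -/
def incl (h : P ⊆ D) : Occ X P ↪ Occ X D :=
  ⟨fun m => ⟨m.1, fun p hp => h (m.2 p hp)⟩,
    fun m m' hm => Subtype.ext (show m.1 = m'.1 from congrArg (fun z => z.1) hm)⟩

open Classical in
/-- `F^P ⊗ F^P' ≅ F^D` for `D` the disjoint union of `P` and `P'`. -/
def split (hd : Disjoint P P') (hu : P ∪ P' = D) : Occ X P × Occ X P' ≃ Occ X D where
  toFun m := ⟨m.1.1 + m.2.1, fun p hp => hu ▸ (Multiset.mem_add.1 hp).imp (m.1.2 p) (m.2.2 p)⟩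
  invFun m := (⟨m.1.filter fun p => p.2 ∈ P, fun _ hp => (Multiset.mem_filter.1 hp).2⟩,
    ⟨m.1.filter fun p => p.2 ∈ P', fun _ hp => (Multiset.mem_filter.1 hp).2⟩)
  left_inv := by
    rintro ⟨⟨m, hm⟩, ⟨m', hm'⟩⟩
    ext1 <;> apply Subtype.ext <;> dsimp only <;> rw [Multiset.filter_add]
    · rw [Multiset.filter_eq_self.2 hm, Multiset.filter_eq_nil.2
        fun p hp hp' => Set.disjoint_left.1 hd hp' (hm' p hp), add_zero]
    · rw [Multiset.filter_eq_self.2 hm', Multiset.filter_eq_nil.2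
        fun p hp hp' => Set.disjoint_left.1 hd (hm p hp) hp', zero_add]
  right_inv := by
    rintro ⟨m, hm⟩
    apply Subtype.ext
    dsimp only
    conv_rhs => rw [← Multiset.filter_add_not (fun p => p.2 ∈ P) m]
    congr 1
    refine Multiset.filter_congr fun p hp => ?_
    have h1 : p.2 ∈ P ∪ P' := hu ▸ hm p hp
    exact ⟨fun h h' => Set.disjoint_left.1 hd h' h, fun h => h1.resolve_left h⟩

/-- `|m⟩ ↦ |Ω⟩_R ⊗ |m⟩_Y`, where the wire `RY` carries the messages `R ⊕ Y`. -/
def inr (R Y : Type) (P : Set T) : Occ Y P ↪ Occ (R ⊕ Y) P :=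
  ⟨fun m => ⟨m.1.map fun p => (Sum.inr p.1, p.2), fun p hp => by
      obtain ⟨q, hq, rfl⟩ := Multiset.mem_map.1 hp
      exact m.2 q hq⟩,
    fun m m' h => Subtype.ext (Multiset.map_injective
      (fun p q hpq => by
        simp only [Prod.mk.injEq, Sum.inr.injEq] at hpq
        exact Prod.ext hpq.1 hpq.2) (congrArg Subtype.val h))⟩

end Occ

/-- The bosonic Fock space `F_X^P` over `ℓ²(P) ⊗ ℂ^X`, in its occupation basis. -/
abbrev Fock (X : Type) {T : Type u} (P : Set T) : Type u := L2 (Occ X P)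

/-- The embedding of `F_X^P` in `F_X^D` (nothing in the remaining positions), on operators. -/
def embed {X : Type} {T : Type u} {P D : Set T} (h : P ⊆ D) :
    TC (Occ X P) →ₗ[ℂ] TC (Occ X D) := conj (ext (Occ.incl h))

/-- `tr_{D ∖ P}`: trace out all messages in positions in `D ∖ P`. -/
def traceOut {X : Type} {T : Type u} {P D : Set T} (h : P ⊆ D) :
    TC (Occ X D) →ₗ[ℂ] TC (Occ X P) :=
  ptrace (Occ.split (P' := D \ P) Set.disjoint_sdiff_right (Set.union_sdiff_cancel h))

/-- `P_R^Ω : ρ ↦ (⟨Ω|_R ⊗ I_Y) ρ (|Ω⟩_R ⊗ I_Y)`. -/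
def projVacuum (R Y : Type) {T : Type u} (P : Set T) :
    TC (Occ (R ⊕ Y) P) →ₗ[ℂ] TC (Occ Y P) := conj (res (Occ.inr R Y P))

/-! ## Causal boxes -/

/-- The block operator `[ρᵢⱼ]` on `ℓ²(α)ⁿ` is positive. -/
def BlockNonneg {α : Type u} {n : ℕ} (ρ : Fin n → Fin n → TC α) : Prop :=
  ∀ x : Fin n → L2 α, 0 ≤ ∑ i, ∑ j, ⟪x i, (ρ i j).1 (x j)⟫_ℂ

/-- Complete positivity. -/
def IsCP {α β : Type u} (Φ : TC α →ₗ[ℂ] TC β) : Prop :=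
  ∀ (n : ℕ) (ρ : Fin n → Fin n → TC α), BlockNonneg ρ → BlockNonneg fun i j => Φ (ρ i j)

/-- Preservation of the trace. -/
def IsTP {α β : Type u} (Φ : TC α →ₗ[ℂ] TC β) : Prop := ∀ ρ, tr (Φ ρ) = tr ρ

/-- Cuts are lower sets; a cut is bounded if it lies below a single point. -/
abbrev BoundedCut (T : Type u) [PartialOrder T] : Type u :=
  {C : LowerSet T // ∃ t, C ≤ LowerSet.Iic t}

/-- Causality functions on cuts. -/
structure IsCausalityFunction {T : Type u} [PartialOrder T] (χ : LowerSet T → LowerSet T) :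
    Prop where
  map_union : ∀ C D : LowerSet T, χ (C ⊔ D) = χ C ⊔ χ D
  mono : ∀ C D : LowerSet T, C ≤ D → χ C ≤ χ D
  lt : ∀ C : BoundedCut T, C.1 ≠ ⊥ → χ C.1 < C.1
  finite : ∀ C : BoundedCut T, ∀ t ∈ C.1, ∃ n : ℕ, t ∉ χ^[n] C.1

/-- A family of linear maps `Φ^C : TC(F_X^T) → TC(F_Y^C)`, one for each bounded cut `C`. -/
abbrev BoxMaps (T : Type u) [PartialOrder T] (X Y : Type) : Type u :=
  ∀ C : BoundedCut T, TC (Occ X (Set.univ : Set T)) →ₗ[ℂ] TC (Occ Y (C.1 : Set T))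

/-- `Φ^C = Φ^C ∘ tr_{T ∖ χ(C)}` for all bounded cuts `C`. -/
def RespectsCausality {T : Type u} [PartialOrder T] {X Y : Type} (Φ : BoxMaps T X Y)
    (χ : LowerSet T → LowerSet T) : Prop :=
  ∀ (C : BoundedCut T) (ρ : TC (Occ X (Set.univ : Set T))),
    Φ C ρ = Φ C (embed (Set.subset_univ (χ C.1 : Set T)) (traceOut (Set.subset_univ _) ρ))

/-- Causal boxes: mutually consistent CPTP maps that respect some causality function. -/
structure IsCausalBox {T : Type u} [PartialOrder T] {X Y : Type} (Φ : BoxMaps T X Y) : Prop where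
  cp : ∀ C, IsCP (Φ C)
  tp : ∀ C, IsTP (Φ C)
  consistent : ∀ (C D : BoundedCut T) (h : (C.1 : Set T) ⊆ D.1)
    (ρ : TC (Occ X (Set.univ : Set T))),
    Φ C ρ = traceOut h (Φ D ρ)
  causal : ∃ χ, IsCausalityFunction χ ∧ RespectsCausality Φ χ

/-- Subnormalized causal boxes: `Φ^C = P_R^Ω ∘ Ψ^C` for a causal box `Ψ` with output wire `RY`. -/
structure IsSubnormalizedCausalBox {T : Type u} [PartialOrder T] {X Y : Type}
    (Φ : BoxMaps T X Y) : Prop where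
  cp : ∀ C, IsCP (Φ C)
  dilation : ∃ (d : ℕ) (Ψ : BoxMaps T X (Fin d ⊕ Y)), IsCausalBox Ψ ∧
    ∀ C ρ, Φ C ρ = projVacuum (Fin d) Y _ (Ψ C ρ)

/-- `Φ^C` as a map `TC(F_X^P) → TC(F_Y^C)`, for the embedded subspace `F_X^P`; used with
`P = χ(C)`. -/
def onInput {T : Type u} [PartialOrder T] {X Y : Type} (Φ : BoxMaps T X Y) (C : BoundedCut T)
    (P : Set T) : TC (Occ X P) →ₗ[ℂ] TC (Occ Y (C.1 : Set T)) :=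
  Φ C ∘ₗ embed (Set.subset_univ P)

/-! ## Sequence representations -/

/-- The operator `A ⊗ I`. -/
def tensorId {β : Type u} (A : L2 β →L[ℂ] L2 β) (κ : Type u) : L2 (β × κ) →L[ℂ] L2 (β × κ) :=
  ampl (Equiv.prodComm κ β) (Equiv.prodComm κ β) A

/-- `U` is a minimal Stinespring representation of `Φ`, with ancilla `ℓ²(κ)`:
`Φ(ρ) = tr_κ (U ρ U†)`, and the vectors `(A ⊗ I) U x` span a dense subspace. -/
structure IsMinimalStinespring {α β κ : Type u} (Φ : TC α →ₗ[ℂ] TC β)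
    (U : L2 α →L[ℂ] L2 (β × κ)) : Prop where
  dilates : ∀ ρ, Φ ρ = ptrace (Equiv.refl (β × κ)) (conj U ρ)
  minimal : (Submodule.span ℂ {v | ∃ (A : L2 β →L[ℂ] L2 β) (x : L2 α),
    v = tensorId A κ (U x)}).topologicalClosure = ⊤

section Sequence

variable {T : Type u} (X Y : Type) (c : ℕ → Set T) (hc : Antitone c) (κ : ℕ → Type u)

/-- The labels of the space `F_Y^{C_n} ⊗ Q_n ⊗ F_X^{C_1 ∖ C_{n+1}}`, for cuts numbered from `0`. -/
abbrev Stage (n : ℕ) : Type u := (Occ Y (c n) × κ n) × Occ X (c 1 \ c (n + 1))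

theorem disjoint_diffs {P P' P'' : Set T} : Disjoint (P' \ P'') (P \ P') :=
  Set.disjoint_left.2 fun _ h h' => h'.2 h.1

theorem union_diffs {P P' P'' : Set T} (h : P' ⊆ P) (h' : P'' ⊆ P') :
    P' \ P'' ∪ P \ P' = P \ P'' := by
  rw [Set.union_comm]; exact Set.sdiff_union_sdiff_cancel h h'

/-- The space `F_Y^{C_{n+1}} ⊗ Q_{n+1} ⊗ F_X^{C_1 ∖ C_{n+2}}` before step `n`, split into the factors on
which the step acts trivially and the input `Q_{n+1} ⊗ F_X^{C_{n+1} ∖ C_{n+2}}` of the step. -/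
def stageIn (n : ℕ) : (Occ Y (c (n + 1)) × Occ X (c 1 \ c (n + 1))) ×
    (κ (n + 1) × Occ X (c (n + 1) \ c (n + 2))) ≃ Stage X Y c κ (n + 1) :=
  Equiv.trans
    { toFun := fun p => ((p.1.1, p.2.1), (p.2.2, p.1.2))
      invFun := fun p => ((p.1.1, p.2.2), (p.1.2, p.2.1))
      left_inv := fun _ => rfl
      right_inv := fun _ => rfl }
    (Equiv.prodCongr (Equiv.refl _)
      (Occ.split disjoint_diffs (union_diffs (hc (by omega)) (hc (by omega)))))

/-- The space `F_Y^{C_n} ⊗ Q_n ⊗ F_X^{C_1 ∖ C_{n+1}}` after step `n`, split into the factors on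
which the step acts trivially and the output `F_Y^{C_n ∖ C_{n+1}} ⊗ Q_n` of the step. -/
def stageOut (n : ℕ) : (Occ Y (c (n + 1)) × Occ X (c 1 \ c (n + 1))) ×
    (Occ Y (c n \ c (n + 1)) × κ n) ≃ Stage X Y c κ n :=
  Equiv.trans
    { toFun := fun p => (((p.1.1, p.2.1), p.2.2), p.1.2)
      invFun := fun p => ((p.1.1.1, p.2), (p.1.1.2, p.1.2))
      left_inv := fun _ => rfl
      right_inv := fun _ => rfl }
    (Equiv.prodCongr (Equiv.prodCongr (Occ.split Set.disjoint_sdiff_right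
      (Set.union_sdiff_cancel (hc (Nat.le_succ n)))) (Equiv.refl _)) (Equiv.refl _))

/-- Operators `U_n : F_X^{C_{n+1}} → F_Y^{C_n} ⊗ Q_n`. -/
abbrev Dilations : Type u :=
  ∀ n, Fock X (c (n + 1)) →L[ℂ] L2 (Occ Y (c n) × κ n)

/-- Operators `V_n : Q_{n+1} ⊗ F_X^{C_{n+1} ∖ C_{n+2}} → F_Y^{C_n ∖ C_{n+1}} ⊗ Q_n`. -/
abbrev Steps : Type u :=
  ∀ n, L2 (κ (n + 1) × Occ X (c (n + 1) \ c (n + 2))) →L[ℂ] L2 (Occ Y (c n \ c (n + 1)) × κ n)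

/-- `I_Y^{C_{n+1}} ⊗ V_n ⊗ I_X^{C_1 ∖ C_{n+1}}`. -/
def stepOp (V : Steps X Y c κ) (n : ℕ) : L2 (Stage X Y c κ (n + 1)) →L[ℂ] L2 (Stage X Y c κ n) :=
  ampl (stageIn X Y c hc κ n) (stageOut X Y c hc κ n) (V n)

/-- The product of the first `n` steps, the last one innermost. For `n = 0` it is the identification
`F_Y^{C_0} ⊗ Q_0 ⊗ F_X^∅ ≅ F_Y^{C_0} ⊗ Q_0`, since `F_X^∅` is spanned by the vacuum. -/
def prodOp (V : Steps X Y c κ) : ∀ n, L2 (Stage X Y c κ n) →L[ℂ] L2 (Occ Y (c 0) × κ 0)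
  | 0 => res (slice (Equiv.refl _) Occ.vac)
  | n + 1 => prodOp V n ∘L stepOp X Y c hc κ V n

/-- `U_n ⊗ I_X^{C_1 ∖ C_{n+1}}`. -/
def startOp (U : Dilations X Y c κ) (n : ℕ) :
    Fock X (c 1) →L[ℂ] L2 (Stage X Y c κ n) :=
  ampl ((Equiv.prodComm _ _).trans (Occ.split Set.disjoint_sdiff_right
    (Set.union_sdiff_cancel (hc (Nat.le_add_left 1 n))))) (Equiv.prodComm _ _) (U n)

end Sequence

/-- A sequence representation of `Φ^C : TC(F_X^{χ(C)}) → TC(F_Y^C)`, with cuts numbered from `0`: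
cuts `C = C_0 ⊇ C_1 ⊇ ⋯` with empty intersection and `χ(C_n) = C_{n+1}`, minimal Stinespring
representations `U_n` of `Φ^{C_n} : TC(F_X^{C_{n+1}}) → TC(F_Y^{C_n})`, and operators `V_n` such that,
for all `n ≥ 1`,
`U_0 = (∏_{i < n} I_Y^{C_{i+1}} ⊗ V_i ⊗ I_X^{C_1 ∖ C_{i+1}}) (U_n ⊗ I_X^{C_1 ∖ C_{n+1}})`. -/
structure IsSequenceRepresentation {T : Type u} [PartialOrder T] {X Y : Type}
    (Φ : BoxMaps T X Y) (χ : LowerSet T → LowerSet T) (C : BoundedCut T)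
    (c : ℕ → BoundedCut T) (κ : ℕ → Type u)
    (U : Dilations X Y (fun n => ((c n).1 : Set T)) κ)
    (V : Steps X Y (fun n => ((c n).1 : Set T)) κ) : Prop where
  zero : c 0 = C
  succ : ∀ n, (c (n + 1)).1 = χ (c n).1
  anti : Antitone fun n => ((c n).1 : Set T)
  iInter : ⋂ n, ((c n).1 : Set T) = ∅
  stinespring : ∀ n, IsMinimalStinespring (onInput Φ (c n) (c (n + 1)).1) (U n)
  factor : ∀ n, 1 ≤ n → U 0 =
    prodOp X Y (fun n => ((c n).1 : Set T)) anti κ V n ∘L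
      startOp X Y (fun n => ((c n).1 : Set T)) anti κ U n

end CausalBoxes

end

open CausalBoxes

noncomputable section

namespace CausalBoxes

open scoped ComplexOrder InnerProductSpace

/-! ## Coordinates and slices -/

/-! Write `(⟨b| ⊗ I) U x` for the slices of a dilation `U`. Since `Φ(ρ) = tr_Q (U ρ U†)`, the inner
products of these slices are matrix entries of `Φ(|y⟩⟨x|)`. Both halves of the proof reduce to
comparing Gram matrices of slices.

Existence of a minimal dilation is Kolmogorov's construction. Complete positivity says that the
kernel `⟨b'|Φ(|y⟩⟨x|)|b⟩` on pairs `(b, x)` is positive, so it is the Gram kernel of vectors with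
dense span in some `ℓ²(κ)` (`exists_kernel_vectors`), which are then declared to be the slices of
`U`. This fixes `tr_Q (U ρ U†)` on rank one operators only. The passage to all trace class `ρ` needs
normality of `Φ`, which is derived from positivity and the trace bound (`IsCP.hasSum_inner`).

For the operators `V`, let `D ⊆ C` and `E = χ(D)`. Slicing `U^C` only along the outputs in `D`
leaves vectors in `F_Y^{C∖D} ⊗ Q`, with Gram matrix given by `tr_{C∖D} ∘ Φ^C`. Slicing `U^D ⊗ I` in
the same way leaves vectors in `Q' ⊗ F_X^{D∖E}`, with Gram matrix given by `Φ^D ∘ tr_{D∖E}`.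
Consistency of outputs and causality of inputs make the two agree. The second family has dense span
by minimality, so sending it to the first defines an isometry `V` with `U^C = (I ⊗ V)(U^D ⊗ I)`
(`exists_contraction`, `exists_factor_contraction`). Iterating along `χⁿ(C)`, the product
telescopes.

In the subnormalized case the first Gram matrix is only dominated by the second: tracing out
positions after projecting `R` on the vacuum drops nonnegative terms. Then `V` is a contraction.
`IsSubconsistent` isolates what both cases share. -/

theorem inner_ext_left {α β : Type u} (j : α ↪ β) (f : L2 α) (g : L2 β) :
    ⟪ext j f, g⟫_ℂ = ⟪f, res j g⟫_ℂ := ContinuousLinearMap.adjoint_inner_left _ _ _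

theorem inner_ext_right {α β : Type u} (j : α ↪ β) (f : L2 α) (g : L2 β) :
    ⟪g, ext j f⟫_ℂ = ⟪res j g, f⟫_ℂ := ContinuousLinearMap.adjoint_inner_right _ _ _

theorem ext_ket {α β : Type u} (j : α ↪ β) (a : α) : ext j (ket a) = ket (j a) :=
  ext_inner_right ℂ fun g => by rw [inner_ext_left, inner_ket, inner_ket, res_apply]

theorem inner_ket_right {ι : Type u} (i : ι) (f : L2 ι) : ⟪f, ket i⟫_ℂ = star (f i) := by
  rw [← inner_conj_symm, inner_ket]; rfl

theorem res_ket {α β : Type u} (j : α ↪ β) (a : α) : res j (ket (j a)) = ket a := by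
  classical
  ext a'
  simp [ket_apply, j.injective.eq_iff]

theorem res_ext {α β : Type u} (j : α ↪ β) (f : L2 α) : res j (ext j f) = f := by
  ext a
  rw [← inner_ket, ← inner_ext_left, ext_ket, inner_ext_right, res_ket, inner_ket]

theorem ext_apply {α β : Type u} (j : α ↪ β) (f : L2 α) (a : α) : ext j f (j a) = f a := by
  rw [← res_apply, res_ext]

theorem ext_apply_of_notMem {α β : Type u} (j : α ↪ β) (f : L2 α) (b : β)
    (hb : b ∉ Set.range j) : ext j f b = 0 := by
  classical
  rw [← inner_ket, inner_ext_right]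
  have : res j (ket b) = 0 := by
    ext a
    rw [res_apply, ket_apply, if_neg fun h => hb ⟨a, h⟩]
    rfl
  rw [this, inner_zero_left]

theorem hasSum_inner_coord {ι : Type u} (f g : L2 ι) :
    HasSum (fun i => star (f i) * g i) ⟪f, g⟫_ℂ := by
  have := lp.hasSum_inner (𝕜 := ℂ) f g
  convert! this using 2 with i
  exact (RCLike.inner_apply' _ _).symm

theorem hasSum_inner_sliceR {α β γ : Type u} (e : α × β ≃ γ) (f g : L2 γ) :
    HasSum (fun a => ⟪res (sliceR e a) f, res (sliceR e a) g⟫_ℂ) ⟪f, g⟫_ℂ := by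
  have h := (e.hasSum_iff (f := fun c => star (f c) * g c)).2 (hasSum_inner_coord f g)
  exact h.prod_fiberwise fun a => hasSum_inner_coord (res (sliceR e a) f) (res (sliceR e a) g)

theorem hasSum_inner_slice {α β γ : Type u} (e : α × β ≃ γ) (f g : L2 γ) :
    HasSum (fun b => ⟪res (slice e b) f, res (slice e b) g⟫_ℂ) ⟪f, g⟫_ℂ :=
  hasSum_inner_sliceR ((Equiv.prodComm β α).trans e) f g

theorem eq_zero_of_sliceR {α β γ : Type u} (e : α × β ≃ γ) (f : L2 γ)
    (h : ∀ a, res (sliceR e a) f = 0) : f = 0 := by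
  ext c
  obtain ⟨p, rfl⟩ := e.surjective c
  exact congrArg (fun g : L2 β => g p.2) (h p.1)

theorem hasSum_ext_sliceR {α β γ : Type u} (e : α × β ≃ γ) (f : L2 γ) :
    HasSum (fun a => ext (sliceR e a) (res (sliceR e a) f)) f := by
  have h := (e.hasSum_iff (f := fun c => ⟪ket c, f⟫_ℂ • ket c)).2 (hasSum_ket f)
  refine h.prod_fiberwise fun a => ?_
  have h1 := (hasSum_ket (res (sliceR e a) f)).mapL (ext (sliceR e a))
  convert h1 using 2 with b
  rw [map_smul, ext_ket, inner_ket, Function.comp_apply, inner_ket]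
  rfl

theorem ampl_apply {α β γ α' β' : Type u} (e : γ × α ≃ α') (e' : γ × β ≃ β')
    (V : L2 α →L[ℂ] L2 β) (f : L2 α') (c : γ) (b : β) :
    ampl e e' V f (e' (c, b)) = V (res (sliceR e c) f) b := by
  change amplFun e V f (e'.symm (e' (c, b))) = _
  rw [Equiv.symm_apply_apply]
  rfl

/-! ## Nuclear sums -/

/-- `A = ∑ₖ |xₖ⟩⟨yₖ|`, a sum that converges absolutely. -/
structure IsNuclearSum {ι κ : Type u} (A : L2 ι →L[ℂ] L2 ι) (x y : κ → L2 ι) : Prop where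
  summable : Summable fun k => ‖x k‖ * ‖y k‖
  hasSum : ∀ z, HasSum (fun k => ⟪y k, z⟫_ℂ • x k) (A z)

namespace IsNuclearSum

variable {ι κ α β : Type u} {x y : κ → L2 ι}

theorem inner {A : L2 ι →L[ℂ] L2 ι} (h : IsNuclearSum A x y) (u v : L2 ι) :
    HasSum (fun k => ⟪y k, v⟫_ℂ * ⟪u, x k⟫_ℂ) ⟪u, A v⟫_ℂ := by
  have := (h.hasSum v).mapL (innerSL ℂ u)
  simpa [inner_smul_right] using this

theorem conj {ρ : TC ι} (h : IsNuclearSum ρ.1 x y) (V : L2 ι →L[ℂ] L2 β) :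
    IsNuclearSum (CausalBoxes.conj V ρ).1 (fun k => V (x k)) (fun k => V (y k)) := by
  constructor
  · refine Summable.of_nonneg_of_le (fun i => by positivity) (fun i => ?_)
      (h.summable.mul_left (‖V‖ * ‖V‖))
    calc ‖V (x i)‖ * ‖V (y i)‖ ≤ (‖V‖ * ‖x i‖) * (‖V‖ * ‖y i‖) := by
          gcongr <;> exact V.le_opNorm _
      _ = _ := by ring
  · intro z
    have h1 := (h.hasSum (ContinuousLinearMap.adjoint V z)).mapL V
    simp only [ContinuousLinearMap.adjoint_inner_right, map_smul] at h1
    exact h1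

theorem ptrace {ρ : TC ι} (h : IsNuclearSum ρ.1 x y) (e : α × β ≃ ι) :
    IsNuclearSum (CausalBoxes.ptrace e ρ).1 (fun p : κ × β => res (slice e p.2) (x p.1))
      (fun p => res (slice e p.2) (y p.1)) := by
  refine ⟨summable_slice e h.summable, fun z => ?_⟩
  have hsum : Summable fun p : κ × β =>
      ⟪res (slice e p.2) (y p.1), z⟫_ℂ • res (slice e p.2) (x p.1) := by
    refine Summable.of_norm_bounded ((summable_slice e h.summable).mul_right ‖z‖) fun p => ?_
    rw [norm_smul]
    calc _ ≤ (‖res (slice e p.2) (y p.1)‖ * ‖z‖) * ‖res (slice e p.2) (x p.1)‖ := by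
          gcongr; exact norm_inner_le_norm _ _
      _ = _ := by ring
  have h1 := hsum.prod_symm.hasSum.prod_fiberwise fun b => hasSum_block e h.hasSum b z
  have h2 : HasSum (fun b => block e ρ.1 b z) ((CausalBoxes.ptrace e ρ).1 z) :=
    (summable_block e ρ.2).hasSum.mapL (ContinuousLinearMap.apply ℂ _ z)
  rw [h2.unique h1, ← (Equiv.prodComm κ β).symm.hasSum_iff]
  exact hsum.prod_symm.hasSum

/-- The bridge between Stinespring representations and Gram matrices: summing over the traced factor
turns the entries of `|x⟩⟨y|` into inner products of slices. -/
theorem inner_ptrace {ρ : TC ι} (h : IsNuclearSum ρ.1 x y) (e : α × β ≃ ι) (a a' : α) :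
    HasSum (fun k => ⟪res (sliceR e a') (y k), res (sliceR e a) (x k)⟫_ℂ)
      ⟪ket a, (CausalBoxes.ptrace e ρ).1 (ket a')⟫_ℂ := by
  refine ((h.ptrace e).inner (ket a) (ket a')).prod_fiberwise fun k => ?_
  convert hasSum_inner_coord (res (sliceR e a') (y k)) (res (sliceR e a) (x k)) using 2 with b
  rw [inner_ket, inner_ket_right]
  rfl

end IsNuclearSum

/-- With `S = √|ρ|` and `ρ = W |ρ|`, insert the basis in `ρ = W S S`. Splitting `|ρ|` evenly makes
both families square summable, since `∑ ‖S|i⟩‖²` is the trace of `|ρ|`; `IsCP.hasSum_inner` needs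
this stronger summability. -/
theorem exists_isNuclearSum {ι : Type u} (ρ : TC ι) :
    ∃ x y : ι → L2 ι, (Summable fun k => ‖x k‖ ^ 2) ∧ (Summable fun k => ‖y k‖ ^ 2) ∧
      IsNuclearSum ρ.1 x y := by
  have h : Summable fun i => (⟪ket i, absOp ρ.1 (ket i)⟫_ℂ).re := ρ.2
  obtain ⟨W, hW⟩ := exists_factor ρ.1 (absOp ρ.1) (fun x => (norm_absOp_apply ρ.1 x).ge)
  obtain ⟨S, hS, hsa⟩ := exists_sqrt_absOp ρ.1
  have hn : ∀ i, ‖S (ket i)‖ ^ 2 = (⟪ket i, absOp ρ.1 (ket i)⟫_ℂ).re := fun i => by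
    rw [← hS, ← hsa]
    exact (inner_self_eq_norm_sq (𝕜 := ℂ) _).symm
  have hy : Summable fun i => ‖S (ket i)‖ ^ 2 := h.congr fun i => (hn i).symm
  refine ⟨fun i => W (S (ket i)), fun i => S (ket i), ?_, hy, ?_, fun z => ?_⟩
  · refine Summable.of_nonneg_of_le (fun i => by positivity) (fun i => ?_) (hy.mul_left (‖W‖ ^ 2))
    rw [← mul_pow]
    gcongr
    exact W.le_opNorm _
  · refine Summable.of_nonneg_of_le (fun i => by positivity) (fun i => ?_) (hy.mul_left ‖W‖)
    calc ‖W (S (ket i))‖ * ‖S (ket i)‖ ≤ (‖W‖ * ‖S (ket i)‖) * ‖S (ket i)‖ := by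
          gcongr; exact W.le_opNorm _
      _ = _ := by ring
  · have h1 := (hasSum_ket (S z)).mapL (W.comp S)
    rw [ContinuousLinearMap.comp_apply, hS, ← hW] at h1
    convert h1 using 2 with i
    rw [map_smul, ContinuousLinearMap.comp_apply, hsa]

/-- Square summable families define a trace class operator `∑ₖ |xₖ⟩⟨yₖ|`. -/
theorem exists_nuclearSum {ι κ : Type u} {x y : κ → L2 ι} (hx : Summable fun k => ‖x k‖ ^ 2)
    (hy : Summable fun k => ‖y k‖ ^ 2) : ∃ ρ : TC ι, IsNuclearSum ρ.1 x y := by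
  have hs : Summable fun k => ‖x k‖ * ‖y k‖ := by
    refine Summable.of_nonneg_of_le (fun i => by positivity) (fun i => ?_) (hx.add hy)
    nlinarith [sq_nonneg (‖x i‖ - ‖y i‖), sq_nonneg (‖x i‖ + ‖y i‖)]
  have hr : Summable fun k => InnerProductSpace.rankOne ℂ (x k) (y k) :=
    Summable.of_norm (by simpa using hs)
  have h : ∀ z, HasSum (fun k => ⟪y k, z⟫_ℂ • x k)
      ((∑' k, InnerProductSpace.rankOne ℂ (x k) (y k)) z) := fun z => by
    simpa using hr.hasSum.mapL (ContinuousLinearMap.apply ℂ _ z)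
  exact ⟨⟨_, (isTraceClass_iff_isNuclear _).2 ⟨κ, x, y, hs, h⟩⟩, hs, h⟩

/-- The operator `|x⟩⟨y|`. -/
def ketBra {ι : Type u} (x y : L2 ι) : TC ι :=
  ⟨InnerProductSpace.rankOne ℂ x y, (isTraceClass_iff_isNuclear _).2
    ⟨PUnit, fun _ => x, fun _ => y, (hasSum_unique _).summable, fun z => by
      simp⟩⟩

theorem ketBra_apply {ι : Type u} (x y z : L2 ι) : (ketBra x y).1 z = ⟪y, z⟫_ℂ • x := by
  simp [ketBra]

theorem isNuclearSum_ketBra {ι : Type u} (x y : L2 ι) :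
    IsNuclearSum (ketBra x y).1 (fun _ : PUnit.{u + 1} => x) (fun _ => y) :=
  ⟨(hasSum_unique _).summable, fun z => by
    simp [ketBra_apply]⟩

theorem tc_ext {ι : Type u} {ρ σ : TC ι}
    (h : ∀ i j, ⟪ket i, ρ.1 (ket j)⟫_ℂ = ⟪ket i, σ.1 (ket j)⟫_ℂ) : ρ = σ := by
  have hk : ∀ j, ρ.1 (ket j) = σ.1 (ket j) := fun j => by
    ext i
    rw [← inner_ket, h, inner_ket]
  refine Subtype.ext (ContinuousLinearMap.ext fun z => ?_)
  refine ((hasSum_ket z).mapL ρ.1).unique ?_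
  convert (hasSum_ket z).mapL σ.1 using 2 with j
  rw [map_smul, map_smul, hk]

theorem conj_ketBra {α β : Type u} (V : L2 α →L[ℂ] L2 β) (x y : L2 α) :
    conj V (ketBra x y) = ketBra (V x) (V y) := by
  refine Subtype.ext (ContinuousLinearMap.ext fun z => ?_)
  rw [ketBra_apply]
  change V ((ketBra x y).1 (ContinuousLinearMap.adjoint V z)) = _
  rw [ketBra_apply, map_smul, ContinuousLinearMap.adjoint_inner_right]

theorem ketBra_add_left {ι : Type u} (x x' y : L2 ι) :
    ketBra (x + x') y = ketBra x y + ketBra x' y :=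
  Subtype.ext (ContinuousLinearMap.ext fun z => by simp [ketBra])

theorem ketBra_smul_left {ι : Type u} (c : ℂ) (x y : L2 ι) :
    ketBra (c • x) y = c • ketBra x y :=
  Subtype.ext (ContinuousLinearMap.ext fun z => by simp [ketBra])

theorem ketBra_smul_right {ι : Type u} (c : ℂ) (x y : L2 ι) :
    ketBra x (c • y) = star c • ketBra x y :=
  Subtype.ext (ContinuousLinearMap.ext fun z => by simp [ketBra])

theorem inner_ptrace_ketBra {α β γ : Type u} (e : α × β ≃ γ) (x y : L2 γ) (a a' : α) :
    ⟪ket a, (ptrace e (ketBra x y)).1 (ket a')⟫_ℂ =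
      ⟪res (sliceR e a') y, res (sliceR e a) x⟫_ℂ :=
  ((isNuclearSum_ketBra x y).inner_ptrace e a a').unique (by simp)

theorem hasSum_inner_ptrace {α β γ : Type u} (e : α × β ≃ γ) (ρ : TC γ) (a a' : α) :
    HasSum (fun b => ⟪ket (e (a, b)), ρ.1 (ket (e (a', b)))⟫_ℂ)
      ⟪ket a, (ptrace e ρ).1 (ket a')⟫_ℂ := by
  have h : HasSum (block e ρ.1) (ptrace e ρ).1 := (summable_block e ρ.2).hasSum
  have h2 := (h.mapL (ContinuousLinearMap.apply ℂ _ (ket a'))).mapL (innerSL ℂ (ket a))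
  have h3 : (fun b => ⟪ket (e (a, b)), ρ.1 (ket (e (a', b)))⟫_ℂ) = fun b =>
      innerSL ℂ (ket a) (ContinuousLinearMap.apply ℂ _ (ket a') (block e ρ.1 b)) := by
    funext b
    change _ = ⟪ket a, res (slice e b) (ρ.1 (ext (slice e b) (ket a')))⟫_ℂ
    rw [← inner_ext_left, ext_ket, ext_ket]
    rfl
  rw [h3]
  exact h2

/-! ## The trace -/

/-- The trace is the partial trace of `ℓ²(PUnit × ι)` onto its one-dimensional factor, so
convergence is inherited. -/
theorem hasSum_tr {ι : Type u} (ρ : TC ι) : HasSum (fun i => ⟪ket i, ρ.1 (ket i)⟫_ℂ) (tr ρ) :=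
  (hasSum_inner_ptrace (Equiv.punitProd.{u, u} ι) ρ PUnit.unit PUnit.unit).summable.hasSum

theorem IsNuclearSum.tr {ι κ : Type u} {ρ : TC ι} {x y : κ → L2 ι} (h : IsNuclearSum ρ.1 x y) :
    HasSum (fun k => ⟪y k, x k⟫_ℂ) (tr ρ) := by
  rw [(hasSum_tr ρ).unique (hasSum_inner_ptrace (Equiv.punitProd.{u, u} ι) ρ PUnit.unit PUnit.unit)]
  exact h.inner_ptrace (Equiv.punitProd.{u, u} ι) PUnit.unit PUnit.unit

theorem tr_ketBra {ι : Type u} (x y : L2 ι) : tr (ketBra x y) = ⟪y, x⟫_ℂ :=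
  (isNuclearSum_ketBra x y).tr.unique (by simp)

theorem tr_conj_ext {α β : Type u} (j : α ↪ β) (ρ : TC α) : tr (conj (ext j) ρ) = tr ρ := by
  obtain ⟨x, y, -, -, h⟩ := exists_isNuclearSum ρ
  refine (h.conj (ext j)).tr.unique ?_
  simpa only [inner_ext_left, res_ext] using h.tr

/-- Positivity of a trace class operator. -/
def Nonneg {ι : Type u} (ρ : TC ι) : Prop := ∀ z, 0 ≤ ⟪z, ρ.1 z⟫_ℂ

theorem Nonneg.re_le_tr {ι : Type u} {ρ : TC ι} (h : Nonneg ρ) (i : ι) :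
    (⟪ket i, ρ.1 (ket i)⟫_ℂ).re ≤ (tr ρ).re :=
  le_hasSum (Complex.hasSum_re (hasSum_tr ρ)) i fun j _ => (Complex.nonneg_iff.1 (h (ket j))).1

/-- Compression by `res j` keeps only some of the nonnegative diagonal entries. -/
theorem Nonneg.tr_conj_res_le {α β : Type u} (j : α ↪ β) {ρ : TC β} (h : Nonneg ρ) :
    (tr (conj (res j) ρ)).re ≤ (tr ρ).re := by
  have h1 := Complex.hasSum_re (hasSum_tr (conj (res j) ρ))
  have h2 := Complex.hasSum_re (hasSum_tr ρ)
  refine hasSum_le_inj j j.injective (fun b _ => (Complex.nonneg_iff.1 (h (ket b))).1)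
    (fun a => le_of_eq ?_) h1 h2
  change (⟪ket a, res j (ρ.1 (ext j (ket a)))⟫_ℂ).re = _
  rw [← inner_ext_left, ext_ket]

/-! ## Vectors with prescribed inner products -/

/-- Positivity is formulated for families over `Fin n`, linear combinations as finitely supported
functions; this translates between them. -/
theorem finsupp_sum_eq_fin_sum {I M : Type*} [AddCommMonoid M] (f : I →₀ ℂ) (h : I → ℂ → M) :
    f.sum h = ∑ j : Fin f.support.card,
      h (f.support.equivFin.symm j) (f (f.support.equivFin.symm j)) := by
  rw [Finsupp.sum, ← Finset.sum_coe_sort f.support fun i => h i (f i)]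
  exact (Equiv.sum_comp f.support.equivFin.symm fun i : f.support => h i (f i)).symm

theorem norm_sum_smul_sq {F : Type*} [NormedAddCommGroup F] [InnerProductSpace ℂ F] {n : ℕ}
    (z : Fin n → ℂ) (u : Fin n → F) :
    ‖∑ j, z j • u j‖ ^ 2 = (∑ j, ∑ k, star (z j) * z k * ⟪u j, u k⟫_ℂ).re := by
  rw [← inner_self_eq_norm_sq (𝕜 := ℂ), sum_inner]
  refine congrArg Complex.re (Finset.sum_congr rfl fun j _ => ?_)
  rw [inner_sum]
  refine Finset.sum_congr rfl fun k _ => ?_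
  rw [inner_smul_left, inner_smul_right, ← mul_assoc]
  rfl

/-- Vectors `u i` whose Gram matrix is dominated by that of vectors `w i` with dense span are the
images of the `w i` under a contraction, which is an isometry if the Gram matrices agree. -/
theorem exists_contraction {I F G : Type*} [NormedAddCommGroup F] [InnerProductSpace ℂ F]
    [CompleteSpace F] [NormedAddCommGroup G] [InnerProductSpace ℂ G] (w : I → G) (u : I → F)
    (hd : (Submodule.span ℂ (Set.range w)).topologicalClosure = ⊤)
    (hle : ∀ (n : ℕ) (i : Fin n → I) (z : Fin n → ℂ),
      (∑ j, ∑ k, star (z j) * z k * ⟪u (i j), u (i k)⟫_ℂ).re ≤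
        (∑ j, ∑ k, star (z j) * z k * ⟪w (i j), w (i k)⟫_ℂ).re) :
    ∃ V : G →L[ℂ] F, ‖V‖ ≤ 1 ∧ (∀ i, V (w i) = u i) ∧
      ((∀ i j, ⟪u i, u j⟫_ℂ = ⟪w i, w j⟫_ℂ) → Isometry V) := by
  -- Work on the free space `I →₀ ℂ`. Domination of the Gram matrices says exactly `‖f x‖ ≤ ‖e x‖`,
  -- so `f` factors through the dense range of `e`, and no well-definedness has to be checked on the
  -- vectors `w i`.
  let f := Finsupp.linearCombination ℂ u
  let e := Finsupp.linearCombination ℂ w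
  have hde : DenseRange e := by
    rw [DenseRange, ← LinearMap.coe_range, Finsupp.range_linearCombination,
      Submodule.dense_iff_topologicalClosure_eq_top]
    exact hd
  have hn : ∀ x, ‖f x‖ ≤ 1 * ‖e x‖ := fun x => by
    rw [one_mul]
    refine le_of_sq_le_sq ?_ (norm_nonneg _)
    simp only [f, e, Finsupp.linearCombination_apply, finsupp_sum_eq_fin_sum]
    rw [norm_sum_smul_sq, norm_sum_smul_sq]
    exact hle _ _ _
  have hV : ∀ x, f.extendOfNorm e (e x) = f x := LinearMap.extendOfNorm_eq hde ⟨1, hn⟩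
  refine ⟨f.extendOfNorm e, LinearMap.opNorm_extendOfNorm_le hde zero_le_one hn, fun i => ?_,
    fun h => AddMonoidHomClass.isometry_of_norm _ fun x => ?_⟩
  · simpa [f, e] using hV (Finsupp.single i 1)
  · refine hde.induction_on (p := fun x => ‖f.extendOfNorm e x‖ = ‖x‖) x
      (isClosed_eq (by fun_prop) (by fun_prop)) fun x => ?_
    rw [hV]
    refine (sq_eq_sq₀ (norm_nonneg _) (norm_nonneg _)).1 ?_
    simp only [f, e, Finsupp.linearCombination_apply, finsupp_sum_eq_fin_sum]
    rw [norm_sum_smul_sq, norm_sum_smul_sq]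
    simp_rw [h]

/-- Polarization: nonnegative complex numbers are real, and the vanishing imaginary parts for the
coefficients `(1,0)`, `(0,1)`, `(1,1)`, `(1,i)` give Hermitian symmetry. -/
theorem kernel_conj_symm {S : Type*} {k : S → S → ℂ}
    (hp : ∀ (n : ℕ) (s : Fin n → S) (z : Fin n → ℂ),
      0 ≤ ∑ i, ∑ j, star (z i) * z j * k (s i) (s j)) (s t : S) : star (k s t) = k t s := by
  have h0 := (Complex.nonneg_iff.1 (hp 2 ![s, t] ![1, 0])).2
  have h1 := (Complex.nonneg_iff.1 (hp 2 ![s, t] ![0, 1])).2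
  have h2 := (Complex.nonneg_iff.1 (hp 2 ![s, t] ![1, 1])).2
  have h3 := (Complex.nonneg_iff.1 (hp 2 ![s, t] ![1, Complex.I])).2
  simp [Fin.sum_univ_two] at h0 h1 h2 h3
  apply Complex.ext <;> simp <;> linarith

/-- A positive kernel is the Gram kernel of vectors with dense span in some `ℓ²(κ)`. -/
theorem exists_kernel_vectors {S : Type u} (k : S → S → ℂ)
    (hp : ∀ (n : ℕ) (s : Fin n → S) (z : Fin n → ℂ),
      0 ≤ ∑ i, ∑ j, star (z i) * z j * k (s i) (s j)) :
    ∃ (κ : Type u) (v : S → L2 κ), (∀ s t, ⟪v s, v t⟫_ℂ = k s t) ∧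
      (Submodule.span ℂ (Set.range v)).topologicalClosure = ⊤ := by
  have hh := kernel_conj_symm hp
  -- The scalar kernel becomes an operator-valued one on `ℂ`. The vectors are the kernel functions
  -- of its reproducing kernel Hilbert space, carried to `ℓ²(κ)` by a Hilbert basis.
  let K : Matrix S S (ℂ →L[ℂ] ℂ) := Matrix.of fun s t => k s t • ContinuousLinearMap.id ℂ ℂ
  have hK : K.PosSemidef := by
    refine ((RKHS.posSemidef_tfae (K := K)).out 0 2).2 (And.intro ?_ fun f => ?_)
    · ext s t
      simp only [K, Matrix.conjTranspose_apply, Matrix.of_apply, star_smul, hh]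
      simp [ContinuousLinearMap.star_eq_adjoint, ContinuousLinearMap.adjoint_id]
    · rw [finsupp_sum_eq_fin_sum f]
      simp_rw [finsupp_sum_eq_fin_sum f]
      refine le_of_le_of_eq (Complex.nonneg_iff.1 (hp _ (fun j => (f.support.equivFin.symm j : S))
        fun j => f (f.support.equivFin.symm j))).1 (congrArg Complex.re ?_)
      refine Finset.sum_congr rfl fun i _ => Finset.sum_congr rfl fun j _ => ?_
      simp only [K, Matrix.of_apply, smul_apply, ContinuousLinearMap.id_apply,
        RCLike.inner_apply', smul_eq_mul, map_mul]
      rw [← hh]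
      simp only [RCLike.star_def]
      ring
  have : Fact K.PosSemidef := ⟨hK⟩
  let H := RKHS.OfKernel K
  obtain ⟨κ, b, -⟩ := exists_hilbertBasis ℂ H
  let v : S → H := fun s => RKHS.kerFun H s 1
  have hv : ∀ s t, ⟪v s, v t⟫_ℂ = k s t := fun s t => by
    have := RKHS.kernel_inner H t s (1 : ℂ) (1 : ℂ)
    rw [RKHS.OfKernel.kernel_ofKernel] at this
    rw [← this, ← hh]
    simp [K]
  have hd : (Submodule.span ℂ (Set.range v)).topologicalClosure = ⊤ := by
    rw [eq_top_iff, ← RKHS.kerFun_dense (H := H)]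
    refine Submodule.topologicalClosure_mono (Submodule.span_le.2 ?_)
    rintro _ ⟨s, c, rfl⟩
    have : RKHS.kerFun H s c = c • v s := by
      rw [← map_smul, smul_eq_mul, mul_one]
    rw [this]
    exact Submodule.smul_mem _ _ (Submodule.subset_span ⟨s, rfl⟩)
  refine ⟨κ, fun s => b.repr (v s), fun s t => by rw [LinearIsometryEquiv.inner_map_map, hv], ?_⟩
  rw [← Submodule.dense_iff_topologicalClosure_eq_top] at hd ⊢
  have := b.repr.surjective.denseRange.dense_image b.repr.continuous hd
  convert this
  rw [Set.range_comp' b.repr v, ← LinearIsometryEquiv.coe_toLinearEquiv, ← LinearEquiv.coe_coe,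
    Submodule.span_image]
  rfl

/-! ## Completely positive maps are determined by their values on `|x⟩⟨y|` -/

/-- The quadratic form equals `∑ₖ |∑ᵢ ⟨wᵢₖ, xᵢ⟩|²`. -/
theorem blockNonneg_of_isNuclearSum {ι κ : Type u} {n : ℕ} {ρ : Fin n → Fin n → TC ι}
    {w : Fin n → κ → L2 ι} (h : ∀ i j, IsNuclearSum (ρ i j).1 (w i) (w j)) : BlockNonneg ρ := by
  intro x
  have hs : HasSum (fun k => ∑ i, ∑ j, ⟪w j k, x j⟫_ℂ * ⟪x i, w i k⟫_ℂ)
      (∑ i, ∑ j, ⟪x i, (ρ i j).1 (x j)⟫_ℂ) :=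
    hasSum_sum fun i _ => hasSum_sum fun j _ => (h i j).inner _ _
  refine hs.nonneg fun k => ?_
  have : ∑ i, ∑ j, ⟪w j k, x j⟫_ℂ * ⟪x i, w i k⟫_ℂ =
      star (∑ i, ⟪w i k, x i⟫_ℂ) * ∑ i, ⟪w i k, x i⟫_ℂ := by
    rw [star_sum, Finset.sum_mul_sum]
    refine Finset.sum_congr rfl fun i _ => Finset.sum_congr rfl fun j _ => ?_
    rw [mul_comm, ← inner_conj_symm (x i)]
    rfl
  rw [this]
  exact star_mul_self_nonneg _

theorem blockNonneg_ketBra {ι : Type u} {n : ℕ} (x : Fin n → L2 ι) :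
    BlockNonneg fun i j => ketBra (x i) (x j) :=
  blockNonneg_of_isNuclearSum (w := fun i (_ : PUnit.{u + 1}) => x i) fun _ _ =>
    isNuclearSum_ketBra _ _

theorem BlockNonneg.nonneg {ι : Type u} {n : ℕ} {ρ : Fin n → Fin n → TC ι} (h : BlockNonneg ρ)
    (i : Fin n) : Nonneg (ρ i i) := by
  classical
  intro z
  have := h (Pi.single i z)
  rw [Finset.sum_eq_single i, Finset.sum_eq_single i] at this
  · simpa using this
  · intro j _ hj
    simp [hj]
  · simp
  · intro j _ hj
    simp [hj]
  · simp

/-- An additive Cauchy–Schwarz inequality. Testing positivity on `(a, d b)` with `d = ±1, ±i` bounds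
the real and the imaginary part each by half of the right side. -/
theorem BlockNonneg.norm_inner_le {ι : Type u} {ρ : Fin 2 → Fin 2 → TC ι} (h : BlockNonneg ρ)
    (a b : L2 ι) :
    ‖⟪a, (ρ 0 1).1 b⟫_ℂ‖ ≤ (⟪a, (ρ 0 0).1 a⟫_ℂ).re + (⟪b, (ρ 1 1).1 b⟫_ℂ).re := by
  have key : ∀ d : ℂ, 0 ≤ ⟪a, (ρ 0 0).1 a⟫_ℂ + d * ⟪a, (ρ 0 1).1 b⟫_ℂ +
      (⟪b, (ρ 1 0).1 a⟫_ℂ * star d + d * (⟪b, (ρ 1 1).1 b⟫_ℂ * star d)) := fun d => by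
    have := h ![a, d • b]
    simpa [Fin.sum_univ_two, inner_smul_left, inner_smul_right] using this
  refine (Complex.norm_le_abs_re_add_abs_im _).trans ?_
  have h1 := Complex.nonneg_iff.1 (key 1)
  have h2 := Complex.nonneg_iff.1 (key (-1))
  have h3 := Complex.nonneg_iff.1 (key Complex.I)
  have h4 := Complex.nonneg_iff.1 (key (-Complex.I))
  simp at h1 h2 h3 h4
  obtain ⟨h1, h1'⟩ := h1
  obtain ⟨h2, h2'⟩ := h2
  obtain ⟨h3, h3'⟩ := h3
  obtain ⟨h4, h4'⟩ := h4
  cases abs_cases (⟪a, (ρ 0 1).1 b⟫_ℂ).re <;> cases abs_cases (⟪a, (ρ 0 1).1 b⟫_ℂ).im <;> linarith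

theorem IsNuclearSum.compl {ι κ : Type u} {ρ : TC ι} {x y : κ → L2 ι} (h : IsNuclearSum ρ.1 x y)
    (s : Finset κ) : IsNuclearSum (ρ - ∑ k ∈ s, ketBra (x k) (y k)).1
      (fun k : {k // k ∉ s} => x k) (fun k => y k) := by
  refine ⟨h.summable.comp_injective Subtype.val_injective, fun z => ?_⟩
  refine (s.hasSum_compl_iff (f := fun k => ⟪y k, z⟫_ℂ • x k)).2 ?_
  convert h.hasSum z using 1
  simp [AddSubgroupClass.coe_sub, ketBra_apply]

/-- The map does not increase the trace of positive operators. -/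
def IsTraceNonincreasing {α β : Type u} (Φ : TC α →ₗ[ℂ] TC β) : Prop :=
  ∀ ρ, Nonneg ρ → (tr (Φ ρ)).re ≤ (tr ρ).re

/-- Normality without any assumed continuity. The tail `∑ |xₖ⟩⟨yₖ|` over `k ∉ s` is an off-diagonal
block of a positive 2×2 block operator with diagonal blocks `∑ |xₖ⟩⟨xₖ|` and `∑ |yₖ⟩⟨yₖ|`. Applying
`Φ` keeps the blocks positive and does not increase the diagonal traces, so entries of the image of
the tail are at most the tails of `∑ ‖xₖ‖²` and `∑ ‖yₖ‖²`. -/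
theorem IsCP.hasSum_inner {α β κ : Type u} {Φ : TC α →ₗ[ℂ] TC β} (hcp : IsCP Φ)
    (htr : IsTraceNonincreasing Φ) {ρ : TC α} {x y : κ → L2 α}
    (hx : Summable fun k => ‖x k‖ ^ 2) (hy : Summable fun k => ‖y k‖ ^ 2)
    (h : IsNuclearSum ρ.1 x y) (i j : β) :
    HasSum (fun k => ⟪ket i, (Φ (ketBra (x k) (y k))).1 (ket j)⟫_ℂ)
      ⟪ket i, (Φ ρ).1 (ket j)⟫_ℂ := by
  have hbound : ∀ s : Finset κ, ‖∑ k ∈ s, ⟪ket i, (Φ (ketBra (x k) (y k))).1 (ket j)⟫_ℂ -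
      ⟪ket i, (Φ ρ).1 (ket j)⟫_ℂ‖ ≤
        (∑' k : {k // k ∉ s}, ‖x k‖ ^ 2) + ∑' k : {k // k ∉ s}, ‖y k‖ ^ 2 := fun s => by
    have hx' : Summable fun k : {k // k ∉ s} => ‖x k‖ ^ 2 :=
      hx.comp_injective Subtype.val_injective
    have hy' : Summable fun k : {k // k ∉ s} => ‖y k‖ ^ 2 :=
      hy.comp_injective Subtype.val_injective
    obtain ⟨σ₀, h₀⟩ := exists_nuclearSum hx' hx'
    obtain ⟨σ₁, h₁⟩ := exists_nuclearSum hy' hx'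
    obtain ⟨σ₂, h₂⟩ := exists_nuclearSum hy' hy'
    have hρ : BlockNonneg ![![σ₀, ρ - ∑ k ∈ s, ketBra (x k) (y k)], ![σ₁, σ₂]] := by
      refine blockNonneg_of_isNuclearSum
        (w := ![fun k : {k // k ∉ s} => x k, fun k : {k // k ∉ s} => y k]) fun i j => ?_
      fin_cases i <;> fin_cases j
      exacts [h₀, h.compl s, h₁, h₂]
    have hΦ := hcp 2 _ hρ
    have tr₀ : (tr σ₀).re = ∑' k : {k // k ∉ s}, ‖x k‖ ^ 2 := by
      rw [← (Complex.hasSum_re h₀.tr).tsum_eq]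
      exact tsum_congr fun k => inner_self_eq_norm_sq (𝕜 := ℂ) _
    have tr₂ : (tr σ₂).re = ∑' k : {k // k ∉ s}, ‖y k‖ ^ 2 := by
      rw [← (Complex.hasSum_re h₂.tr).tsum_eq]
      exact tsum_congr fun k => inner_self_eq_norm_sq (𝕜 := ℂ) _
    have h3 := hΦ.norm_inner_le (ket i) (ket j)
    have h4 := ((hΦ.nonneg 0).re_le_tr i).trans (htr _ (hρ.nonneg 0))
    have h5 := ((hΦ.nonneg 1).re_le_tr j).trans (htr _ (hρ.nonneg 1))
    rw [norm_sub_rev, ← tr₀, ← tr₂]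
    refine le_trans (le_of_eq ?_) (h3.trans (add_le_add h4 h5))
    simp [map_sub, map_sum]
  rw [HasSum, SummationFilter.unconditional_filter, tendsto_iff_norm_sub_tendsto_zero]
  refine squeeze_zero (fun _ => norm_nonneg _) hbound ?_
  simpa using (tendsto_tsum_compl_atTop_zero fun k => ‖x k‖ ^ 2).add
    (tendsto_tsum_compl_atTop_zero fun k => ‖y k‖ ^ 2)

theorem IsCP.eq_ptrace_conj {α β κ : Type u} {Φ : TC α →ₗ[ℂ] TC β} (hcp : IsCP Φ)
    (htr : IsTraceNonincreasing Φ) (U : L2 α →L[ℂ] L2 (β × κ))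
    (h : ∀ x y b b', ⟪ket b, (Φ (ketBra x y)).1 (ket b')⟫_ℂ =
      ⟪res (sliceR (Equiv.refl _) b') (U y), res (sliceR (Equiv.refl _) b) (U x)⟫_ℂ) (ρ : TC α) :
    Φ ρ = ptrace (Equiv.refl (β × κ)) (conj U ρ) := by
  obtain ⟨x, y, hx, hy, hρ⟩ := exists_isNuclearSum ρ
  refine tc_ext fun i j => (hcp.hasSum_inner htr hx hy hρ i j).unique ?_
  simp_rw [h]
  exact (hρ.conj U).inner_ptrace _ i j

/-! ## Minimal Stinespring representations -/

/-- Together with `res_tensorId_ext`, this turns minimality into a statement about slices: `|a⟩⟨b| ⊗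
I` moves the slice at `b` to position `a`. -/
theorem tensorId_ketBra {β κ : Type u} (a b : β) (f : L2 (β × κ)) :
    tensorId (ketBra (ket a) (ket b)).1 κ f =
      ext (sliceR (Equiv.refl _) a) (res (sliceR (Equiv.refl _) b) f) := by
  classical
  ext ⟨a', q⟩
  have h1 : tensorId (ketBra (ket a) (ket b)).1 κ f (a', q) =
      (ketBra (ket a) (ket b)).1 (res (sliceR (Equiv.prodComm κ β) q) f) a' :=
    ampl_apply (Equiv.prodComm κ β) (Equiv.prodComm κ β) _ f q a'
  rw [h1, ketBra_apply, inner_ket]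
  by_cases h : a' = a
  · subst h
    refine Eq.trans ?_ (ext_apply (sliceR (Equiv.refl (β × κ)) a') _ q).symm
    simp [ket_apply]
    rfl
  · rw [ext_apply_of_notMem]
    · simp [ket_apply, h]
    · rintro ⟨q', hq⟩
      exact h (congrArg Prod.fst hq).symm

theorem res_tensorId_ext {β κ : Type u} (A : L2 β →L[ℂ] L2 β) (a b : β) (g : L2 κ) :
    res (sliceR (Equiv.refl (β × κ)) a) (tensorId A κ (ext (sliceR (Equiv.refl _) b) g)) =
      A (ket b) a • g := by
  classical
  ext q
  have h1 : tensorId A κ (ext (sliceR (Equiv.refl _) b) g) (a, q) =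
      A (res (sliceR (Equiv.prodComm κ β) q) (ext (sliceR (Equiv.refl _) b) g)) a :=
    ampl_apply (Equiv.prodComm κ β) (Equiv.prodComm κ β) _ _ q a
  have h2 : res (sliceR (Equiv.prodComm κ β) q) (ext (sliceR (Equiv.refl (β × κ)) b) g) =
      g q • ket b := by
    ext b'
    by_cases h : b' = b
    · subst h
      refine Eq.trans (ext_apply (sliceR (Equiv.refl (β × κ)) b') g q) ?_
      simp [ket_apply]
    · rw [res_apply, ext_apply_of_notMem]
      · simp [ket_apply, h]
      · rintro ⟨q', hq⟩
        exact h (congrArg Prod.fst hq).symm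
  refine h1.trans ?_
  rw [h2, map_smul]
  simp [mul_comm]

theorem topologicalClosure_span_eq_top {H : Type*} [NormedAddCommGroup H] [InnerProductSpace ℂ H]
    [CompleteSpace H] {s : Set H} (h : ∀ q, (∀ v ∈ s, ⟪v, q⟫_ℂ = 0) → q = 0) :
    (Submodule.span ℂ s).topologicalClosure = ⊤ := by
  refine Submodule.orthogonal_eq_bot_iff.mp ((Submodule.eq_bot_iff _).mpr fun q hq => h q ?_)
  intro v hv
  exact Submodule.inner_right_of_mem_orthogonal
    (Submodule.le_topologicalClosure _ (Submodule.subset_span hv)) hq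

theorem eq_zero_of_topologicalClosure_span_eq_top {H : Type*} [NormedAddCommGroup H]
    [InnerProductSpace ℂ H] {s : Set H} (hs : (Submodule.span ℂ s).topologicalClosure = ⊤)
    {q : H} (h : ∀ v ∈ s, ⟪v, q⟫_ℂ = 0) : q = 0 := by
  rw [← Submodule.dense_iff_topologicalClosure_eq_top] at hs
  refine hs.eq_zero_of_inner_right ℂ fun v hv => ?_
  induction hv using Submodule.span_induction with
  | mem v hv => exact h v hv
  | zero => simp
  | add v w _ _ hv hw => rw [inner_add_left, hv, hw, add_zero]
  | smul c v _ hv => rw [inner_smul_left, hv, mul_zero]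

/-- The slices `(⟨b| ⊗ I) U x` of a minimal Stinespring representation span a dense subspace of the
ancilla. -/
theorem IsMinimalStinespring.eq_zero {α β κ : Type u} [Nonempty β] {Φ : TC α →ₗ[ℂ] TC β}
    {U : L2 α →L[ℂ] L2 (β × κ)} (hU : IsMinimalStinespring Φ U) {q : L2 κ}
    (hq : ∀ b x, ⟪res (sliceR (Equiv.refl _) b) (U x), q⟫_ℂ = 0) : q = 0 := by
  obtain ⟨a⟩ := ‹Nonempty β›
  rw [← res_ext (sliceR (Equiv.refl (β × κ)) a) q]
  suffices ext (sliceR (Equiv.refl (β × κ)) a) q = 0 by rw [this, map_zero]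
  refine eq_zero_of_topologicalClosure_span_eq_top hU.minimal ?_
  rintro _ ⟨A, x, rfl⟩
  rw [inner_ext_right]
  -- Expand `U x` into its slices. The slice of `(A ⊗ I) U x` at `a` is then a sum of multiples of
  -- slices of `U x`, each orthogonal to `q`.
  have h := (((hasSum_ext_sliceR (Equiv.refl _) (U x)).mapL (tensorId A κ)).mapL
    (res (sliceR (Equiv.refl (β × κ)) a))).mapL (innerSL ℂ q)
  simp only [res_tensorId_ext, map_smul, innerSL_apply_apply] at h
  have h0 : ∀ b, ⟪q, res (sliceR (Equiv.refl _) b) (U x)⟫_ℂ = 0 := fun b => by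
    rw [← inner_conj_symm, hq, map_zero]
  simp only [h0, smul_zero] at h
  rw [← inner_conj_symm, h.unique hasSum_zero, map_zero]

/-- The Kolmogorov vectors `v (b, x)` serve as the slices of `U x`, and the density of their span is
minimality. -/
theorem exists_isMinimalStinespring {α β : Type u} {Φ : TC α →ₗ[ℂ] TC β} (hcp : IsCP Φ)
    (htr : IsTraceNonincreasing Φ) :
    ∃ (κ : Type u) (U : L2 α →L[ℂ] L2 (β × κ)), IsMinimalStinespring Φ U := by
  obtain ⟨κ, v, hv, hd⟩ := exists_kernel_vectors
    (fun s t : β × L2 α => ⟪ket t.1, (Φ (ketBra t.2 s.2)).1 (ket s.1)⟫_ℂ) (fun n s z => by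
      -- The kernel is linear in its second argument, while block positivity is antilinear in the
      -- outer vector; hence the conjugated coefficients and the interchange of the two sums.
      have h := hcp n _ (blockNonneg_ketBra fun i => (s i).2) fun i => star (z i) • ket (s i).1
      rw [Finset.sum_comm] at h
      refine h.trans_eq (Finset.sum_congr rfl fun i _ => Finset.sum_congr rfl fun j _ => ?_)
      rw [map_smul, inner_smul_left, inner_smul_right]
      simp
      ring)
  -- Linearity in `x` is inherited from the kernel: the defect is orthogonal to every `v s`, and
  -- these span a dense subspace.
  have hadd : ∀ b x y, v (b, x + y) = v (b, x) + v (b, y) := fun b x y => by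
    rw [← sub_eq_zero]
    refine eq_zero_of_topologicalClosure_span_eq_top hd ?_
    rintro _ ⟨s, rfl⟩
    rw [inner_sub_right, inner_add_right, hv, hv, hv]
    simp [ketBra_add_left]
  have hsmul : ∀ b (c : ℂ) x, v (b, c • x) = c • v (b, x) := fun b c x => by
    rw [← sub_eq_zero]
    refine eq_zero_of_topologicalClosure_span_eq_top hd ?_
    rintro _ ⟨s, rfl⟩
    rw [inner_sub_right, inner_smul_right, hv, hv]
    simp [ketBra_smul_left]
  -- The squared norm of `U x` will be the trace of `Φ(|x⟩⟨x|)`, so the trace bound makes `U` a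
  -- well-defined contraction.
  have hn : ∀ x, HasSum (fun b => ‖v (b, x)‖ ^ 2) (tr (Φ (ketBra x x))).re := fun x => by
    convert! Complex.hasSum_re (hasSum_tr (Φ (ketBra x x))) using 2 with b
    rw [← inner_self_eq_norm_sq (𝕜 := ℂ), hv]
    rfl
  have hle : ∀ x, (tr (Φ (ketBra x x))).re ≤ ‖x‖ ^ 2 := fun x => by
    refine (htr _ ((blockNonneg_ketBra fun _ : Fin 1 => x).nonneg 0)).trans_eq ?_
    rw [tr_ketBra]
    exact inner_self_eq_norm_sq (𝕜 := ℂ) x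
  have hs : ∀ x, Summable fun p : β × κ => ‖v (p.1, x) p.2‖ ^ 2 := fun x => by
    refine (summable_prod_of_nonneg fun p => sq_nonneg _).2 ⟨fun b => ?_, ?_⟩
    · exact (hasSum_norm_sq (v (b, x))).summable
    · exact (hn x).summable.congr fun b => (hasSum_norm_sq (v (b, x))).tsum_eq.symm
  let U : L2 α →L[ℂ] L2 (β × κ) := LinearMap.mkContinuous
    { toFun := fun x => ⟨fun p => v (p.1, x) p.2, memℓp_of_sq (hs x)⟩
      map_add' := fun x y => by ext p; exact congrArg (fun f : L2 κ => f p.2) (hadd p.1 x y)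
      map_smul' := fun c x => by ext p; exact congrArg (fun f : L2 κ => f p.2) (hsmul p.1 c x) }
    1 (fun x => by
      rw [one_mul]
      refine le_of_sq_le_sq ?_ (norm_nonneg _)
      refine le_of_eq_of_le ?_ (hle x)
      rw [← (hasSum_norm_sq _).tsum_eq]
      exact ((hs x).hasSum.prod_fiberwise fun b => hasSum_norm_sq (v (b, x))).unique (hn x))
  have hU : ∀ b x, res (sliceR (Equiv.refl _) b) (U x) = v (b, x) := fun b x => rfl
  refine ⟨κ, U, hcp.eq_ptrace_conj htr U fun x y b b' => ?_,
    topologicalClosure_span_eq_top fun w hw => ?_⟩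
  · rw [hU, hU, hv]
  · refine eq_zero_of_sliceR (Equiv.refl (β × κ)) w fun a => ?_
    refine eq_zero_of_topologicalClosure_span_eq_top hd ?_
    rintro _ ⟨⟨b, x⟩, rfl⟩
    have := hw _ ⟨(ketBra (ket a) (ket b)).1, x, rfl⟩
    rwa [tensorId_ketBra, inner_ext_left, hU] at this

/-! ## Comparison of Stinespring representations -/

theorem IsNuclearSum.comp_equiv {ι κ κ' : Type u} {A : L2 ι →L[ℂ] L2 ι} {x y : κ → L2 ι}
    (h : IsNuclearSum A x y) (e : κ' ≃ κ) :
    IsNuclearSum A (fun k => x (e k)) (fun k => y (e k)) :=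
  ⟨(e.summable_iff (f := fun k => ‖x k‖ * ‖y k‖)).2 h.summable, fun z =>
    (e.hasSum_iff (f := fun k => ⟪y k, z⟫_ℂ • x k)).2 (h.hasSum z)⟩

theorem isNuclearSum_ptrace_ketBra {α β γ : Type u} (e : α × β ≃ γ) (x y : L2 γ) :
    IsNuclearSum (ptrace e (ketBra x y)).1 (fun b => res (slice e b) x)
      (fun b => res (slice e b) y) :=
  ((isNuclearSum_ketBra x y).ptrace e).comp_equiv (Equiv.punitProd.{u, u} β).symm

theorem inner_map_ketBra_smul {α β : Type u} (L : TC α →ₗ[ℂ] TC β) (z z' : ℂ) (x y : L2 α)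
    (u v : L2 β) : ⟪u, (L (ketBra (z' • x) (z • y))).1 v⟫_ℂ =
      star z * z' * ⟪u, (L (ketBra x y)).1 v⟫_ℂ := by
  rw [ketBra_smul_left, ketBra_smul_right, map_smul, map_smul, mul_comm (star z), mul_assoc,
    ← inner_smul_right, ← inner_smul_right]
  rfl

theorem res_slice_ext_of_ne {α β γ : Type u} (e : α × β ≃ γ) {b b' : β} (h : b' ≠ b) (f : L2 α) :
    res (slice e b') (ext (slice e b) f) = 0 := by
  ext a
  refine ext_apply_of_notMem _ _ _ ?_
  rintro ⟨a', ha⟩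
  exact h (congrArg Prod.snd (e.injective ha)).symm

section Compare

variable {α α' τ β γ δ κ κ' : Type u} (eX : α' × τ ≃ α) (eY : β × δ ≃ γ)

/-- The regrouping `β ⊗ (δ ⊗ κ) ≅ γ ⊗ κ` for `γ ≅ β ⊗ δ`. -/
def regroup (κ : Type u) : β × (δ × κ) ≃ γ × κ :=
  (Equiv.prodAssoc β δ κ).symm.trans (Equiv.prodCongr eY (Equiv.refl κ))

/-- The operator `U' ⊗ I_τ`. -/
def tensorRight (U' : L2 α' →L[ℂ] L2 (β × κ')) : L2 α →L[ℂ] L2 ((β × κ') × τ) :=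
  ampl ((Equiv.prodComm _ _).trans eX) (Equiv.prodComm _ _) U'

theorem tensorRight_apply (U' : L2 α' →L[ℂ] L2 (β × κ')) (x : L2 α) (p : β × κ') (t : τ) :
    tensorRight eX U' x (p, t) = U' (res (slice eX t) x) p :=
  ampl_apply ((Equiv.prodComm _ _).trans eX) (Equiv.prodComm _ _) U' x t p

/-- Slicing along `β` alone leaves `δ` beside the ancilla, so the inner product also traces out `δ`.
-/
theorem inner_res_regroup (U : L2 α →L[ℂ] L2 (γ × κ)) (x y : L2 α) (b b' : β) :
    ⟪res (sliceR (regroup eY κ) b) (U x), res (sliceR (regroup eY κ) b') (U y)⟫_ℂ =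
      ⟪ket b', (ptrace eY (ptrace (Equiv.refl (γ × κ)) (conj U (ketBra y x)))).1 (ket b)⟫_ℂ := by
  rw [conj_ketBra]
  refine (hasSum_inner_slice (Equiv.refl (δ × κ)) _ _).unique ?_
  exact (isNuclearSum_ptrace_ketBra (Equiv.refl (γ × κ)) (U y) (U x)).inner_ptrace eY b' b

/-- The identity on `τ` acts as an extra ancilla, and summing over it traces `τ` out of the input.
-/
theorem inner_res_tensorRight (U' : L2 α' →L[ℂ] L2 (β × κ')) (x y : L2 α) (b b' : β) :
    ⟪res (sliceR (Equiv.prodAssoc β κ' τ).symm b) (tensorRight eX U' x),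
        res (sliceR (Equiv.prodAssoc β κ' τ).symm b') (tensorRight eX U' y)⟫_ℂ =
      ⟪ket b', (ptrace (Equiv.refl (β × κ')) (conj U' (ptrace eX (ketBra y x)))).1 (ket b)⟫_ℂ := by
  have hs : ∀ (t : τ) (b : β) (x : L2 α), res (slice (Equiv.refl (κ' × τ)) t)
      (res (sliceR (Equiv.prodAssoc β κ' τ).symm b) (tensorRight eX U' x)) =
      res (sliceR (Equiv.refl _) b) (U' (res (slice eX t) x)) := fun t b x => by
    ext k
    exact tensorRight_apply eX U' x (b, k) t
  refine (hasSum_inner_slice (Equiv.refl (κ' × τ)) _ _).unique ?_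
  simp_rw [hs]
  exact ((isNuclearSum_ptrace_ketBra eX y x).conj U').inner_ptrace _ b' b

/-- On an input `x ⊗ |t⟩` the slices of `U' ⊗ I` are those of `U'` tensored with `|t⟩`; this
transfers density from `U'` to `U' ⊗ I`. -/
theorem ext_slice_res (U' : L2 α' →L[ℂ] L2 (β × κ')) (t : τ) (b : β) (x : L2 α') :
    ext (slice (Equiv.refl (κ' × τ)) t) (res (sliceR (Equiv.refl _) b) (U' x)) =
      res (sliceR (Equiv.prodAssoc β κ' τ).symm b)
        (tensorRight eX U' (ext (slice eX t) x)) := by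
  ext ⟨k, t'⟩
  refine Eq.trans ?_ (tensorRight_apply eX U' (ext (slice eX t) x) (b, k) t').symm
  by_cases h : t' = t
  · subst h
    rw [res_ext]
    exact ext_apply (slice (Equiv.refl (κ' × τ)) t') _ k
  · rw [res_slice_ext_of_ne eX h, map_zero]
    exact congrArg (fun f : L2 κ' => f k) (res_slice_ext_of_ne (Equiv.refl (κ' × τ)) h _)

/-- If `tr_δ ∘ Φ` is dominated by `Φ' ∘ tr_τ`, then a dilation `U` of `Φ` factors through the
minimal dilation `U'` of `Φ'` by a contraction `V`, namely `U = (I ⊗ V) (U' ⊗ I)`. -/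
theorem exists_factor_contraction [Nonempty β] {Φ : TC α →ₗ[ℂ] TC γ} {Φ' : TC α' →ₗ[ℂ] TC β}
    {U : L2 α →L[ℂ] L2 (γ × κ)} {U' : L2 α' →L[ℂ] L2 (β × κ')}
    (hU : IsMinimalStinespring Φ U) (hU' : IsMinimalStinespring Φ' U')
    (hle : ∀ (n : ℕ) (x : Fin n → L2 α) (b : Fin n → β),
      (∑ i, ∑ j, ⟪ket (b i), (ptrace eY (Φ (ketBra (x i) (x j)))).1 (ket (b j))⟫_ℂ).re ≤
        (∑ i, ∑ j, ⟪ket (b i), (Φ' (ptrace eX (ketBra (x i) (x j)))).1 (ket (b j))⟫_ℂ).re) :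
    ∃ V : L2 (κ' × τ) →L[ℂ] L2 (δ × κ), ‖V‖ ≤ 1 ∧
      (∀ b x, V (res (sliceR (Equiv.prodAssoc β κ' τ).symm b) (tensorRight eX U' x)) =
        res (sliceR (regroup eY κ) b) (U x)) ∧
      ((∀ x y, ptrace eY (Φ (ketBra x y)) = Φ' (ptrace eX (ketBra x y))) → Isometry V) := by
  let w : β × L2 α → L2 (κ' × τ) := fun p =>
    res (sliceR (Equiv.prodAssoc β κ' τ).symm p.1) (tensorRight eX U' p.2)
  let u : β × L2 α → L2 (δ × κ) := fun p => res (sliceR (regroup eY κ) p.1) (U p.2)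
  have hu : ∀ p q, ⟪u p, u q⟫_ℂ =
      ⟪ket q.1, (ptrace eY (Φ (ketBra q.2 p.2))).1 (ket p.1)⟫_ℂ := fun p q => by
    rw [hU.dilates]
    exact inner_res_regroup eY U p.2 q.2 p.1 q.1
  have hw : ∀ p q, ⟪w p, w q⟫_ℂ =
      ⟪ket q.1, (Φ' (ptrace eX (ketBra q.2 p.2))).1 (ket p.1)⟫_ℂ := fun p q => by
    rw [hU'.dilates]
    exact inner_res_tensorRight eX U' p.2 q.2 p.1 q.1
  -- A vector orthogonal to all `w` has each of its slices at `t` orthogonal to all slices of `U'`,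
  -- hence zero by minimality.
  have hd : (Submodule.span ℂ (Set.range w)).topologicalClosure = ⊤ := by
    refine topologicalClosure_span_eq_top fun q hq => ?_
    refine eq_zero_of_sliceR ((Equiv.prodComm τ κ').trans (Equiv.refl (κ' × τ))) q fun t => ?_
    refine hU'.eq_zero fun b x => ?_
    have := hq _ ⟨(b, ext (slice eX t) x), rfl⟩
    change ⟪res _ (tensorRight eX U' _), q⟫_ℂ = 0 at this
    rw [← ext_slice_res, inner_ext_left] at this
    exact this
  obtain ⟨V, hV, hVw, hiso⟩ := exists_contraction w u hd fun n p z => by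
    have h := hle n (fun i => z i • (p i).2) fun i => (p i).1
    rw [Finset.sum_comm, Finset.sum_comm (f := fun i j => ⟪ket (p i).1, (Φ' (ptrace eX
      (ketBra (z i • (p i).2) (z j • (p j).2)))).1 (ket (p j).1)⟫_ℂ)] at h
    simp_rw [hu, hw]
    refine le_of_eq_of_le (congrArg Complex.re ?_) (h.trans_eq (congrArg Complex.re ?_))
    · refine Finset.sum_congr rfl fun j _ => Finset.sum_congr rfl fun k _ => ?_
      exact (inner_map_ketBra_smul (ptrace eY ∘ₗ Φ) _ _ _ _ _ _).symm
    · refine Finset.sum_congr rfl fun j _ => Finset.sum_congr rfl fun k _ => ?_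
      exact inner_map_ketBra_smul (Φ' ∘ₗ ptrace eX) _ _ _ _ _ _
  refine ⟨V, hV, fun b x => hVw (b, x), fun h => hiso fun p q => ?_⟩
  rw [hu, hw, h]

end Compare

/-! ## Conjugations and partial traces of Fock spaces -/

theorem inner_conj {α β : Type u} (V : L2 α →L[ℂ] L2 β) (ρ : TC α) (u v : L2 β) :
    ⟪u, (conj V ρ).1 v⟫_ℂ = ⟪ContinuousLinearMap.adjoint V u,
      ρ.1 (ContinuousLinearMap.adjoint V v)⟫_ℂ := by
  rw [ContinuousLinearMap.adjoint_inner_left]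
  rfl

theorem inner_conj_res {α β : Type u} (j : α ↪ β) (ρ : TC β) (a a' : α) :
    ⟪ket a, (conj (res j) ρ).1 (ket a')⟫_ℂ = ⟪ket (j a), ρ.1 (ket (j a'))⟫_ℂ := by
  rw [inner_conj, ← ext_ket, ← ext_ket]
  rfl

theorem isCP_conj {α β : Type u} (V : L2 α →L[ℂ] L2 β) : IsCP (conj V) := fun n ρ h x => by
  simp_rw [inner_conj]
  exact h _

theorem Nonneg.conj {α β : Type u} (V : L2 α →L[ℂ] L2 β) {ρ : TC α} (h : Nonneg ρ) :
    Nonneg (conj V ρ) := fun x => by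
  rw [inner_conj]
  exact h _

theorem IsCP.nonneg {α β : Type u} {Φ : TC α →ₗ[ℂ] TC β} (hΦ : IsCP Φ) {ρ : TC α}
    (h : Nonneg ρ) : Nonneg (Φ ρ) :=
  (hΦ 1 (fun _ _ => ρ) fun x => by simpa using h (x 0)).nonneg 0

instance {Y : Type} {T : Type u} {P : Set T} : Nonempty (Occ Y P) := ⟨Occ.vac⟩

variable {T : Type u} {X Y : Type}

theorem Occ.inr_split {R : Type} {P P' D : Set T} (hd : Disjoint P P') (hu : P ∪ P' = D)
    (m : Occ Y P) (m' : Occ Y P') : Occ.inr R Y D (Occ.split hd hu (m, m')) =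
      Occ.split hd hu (Occ.inr R Y P m, Occ.inr R Y P' m') :=
  Subtype.ext (Multiset.map_add _ _ _)

/-- Adding vacuum outside `P` commutes with slicing inside it; at a label with a message outside `P`
both sides vanish. -/
theorem res_sliceR_ext_incl {P P' D : Set T} (h' : P' ⊆ P) (h : P ⊆ D) (x : L2 (Occ X P))
    (m : Occ X P') :
    res (sliceR (Occ.split Set.disjoint_sdiff_right (Set.union_sdiff_cancel (h'.trans h))) m)
        (ext (Occ.incl h) x) =
      ext (Occ.incl (Set.sdiff_subset_sdiff_left h))
        (res (sliceR (Occ.split Set.disjoint_sdiff_right (Set.union_sdiff_cancel h')) m) x) := by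
  ext t
  by_cases ht : ∀ p ∈ t.1, p.2 ∈ P
  · obtain ⟨s, rfl⟩ : ∃ s : Occ X (P \ P'), Occ.incl (Set.sdiff_subset_sdiff_left h) s = t :=
      ⟨⟨t.1, fun p hp => ⟨ht p hp, (t.2 p hp).2⟩⟩, rfl⟩
    rw [ext_apply]
    exact ext_apply (Occ.incl h) x (Occ.split Set.disjoint_sdiff_right
      (Set.union_sdiff_cancel h') (m, s))
  · rw [ext_apply_of_notMem, res_apply, ext_apply_of_notMem]
    · rintro ⟨s, hs⟩
      refine ht fun p hp => s.2 p ?_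
      rw [show s.1 = m.1 + t.1 from congrArg Subtype.val hs]
      exact Multiset.mem_add.2 (Or.inr hp)
    · rintro ⟨s, rfl⟩
      exact ht fun p hp => (s.2 p hp).1

theorem traceOut_embed_ketBra {P P' D : Set T} (h' : P' ⊆ P) (h : P ⊆ D) (x y : L2 (Occ X P)) :
    traceOut (h'.trans h) (embed h (ketBra x y)) = traceOut h' (ketBra x y) := by
  refine tc_ext fun m m' => ?_
  rw [embed, conj_ketBra, traceOut, traceOut, inner_ptrace_ketBra, inner_ptrace_ketBra,
    res_sliceR_ext_incl h' h, res_sliceR_ext_incl h' h, inner_ext_left, res_ext]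

/-! ## Factorization along a decreasing sequence of cuts -/

section Sequence

variable {c : ℕ → Set T} (hc : Antitone c) {κ : ℕ → Type u}

theorem startOp_apply (U : Dilations X Y c κ) (n : ℕ) (f : Fock X (c 1)) (p : Occ Y (c n) × κ n)
    (t : Occ X (c 1 \ c (n + 1))) : startOp X Y c hc κ U n f (p, t) =
      U n (res (slice (Occ.split Set.disjoint_sdiff_right
        (Set.union_sdiff_cancel (hc (Nat.le_add_left 1 n)))) t) f) p :=
  tensorRight_apply (Occ.split Set.disjoint_sdiff_right
    (Set.union_sdiff_cancel (hc (Nat.le_add_left 1 n)))) (U n) f p t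

/-- One factorization `U_n = (I ⊗ V_n)(U_{n+1} ⊗ I)`, tensored with the inputs in `C_1 ∖ C_{n+1}`
that the step leaves alone. -/
theorem stepOp_comp_startOp (U : Dilations X Y c κ) (V : Steps X Y c κ) (n : ℕ)
    (hV : ∀ b x, V n (res (sliceR (Equiv.prodAssoc _ (κ (n + 1)) _).symm b) (tensorRight (Occ.split
        Set.disjoint_sdiff_right (Set.union_sdiff_cancel (hc (Nat.le_succ (n + 1))))) (U (n + 1)) x)) =
        res (sliceR (regroup (Occ.split Set.disjoint_sdiff_right
          (Set.union_sdiff_cancel (hc (Nat.le_succ n)))) (κ n)) b) (U n x)) :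
    stepOp X Y c hc κ V n ∘L startOp X Y c hc κ U (n + 1) = startOp X Y c hc κ U n := by
  ext f p
  obtain ⟨⟨⟨m, t⟩, ⟨s, k⟩⟩, rfl⟩ := (stageOut X Y c hc κ n).surjective p
  rw [ContinuousLinearMap.comp_apply, stepOp, ampl_apply]
  have h : res (sliceR (stageIn X Y c hc κ n) (m, t)) (startOp X Y c hc κ U (n + 1) f) =
      res (sliceR (Equiv.prodAssoc _ (κ (n + 1)) _).symm m) (tensorRight (Occ.split
        Set.disjoint_sdiff_right (Set.union_sdiff_cancel (hc (Nat.le_succ (n + 1))))) (U (n + 1))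
        (res (slice (Occ.split Set.disjoint_sdiff_right
          (Set.union_sdiff_cancel (hc (Nat.le_add_left 1 n)))) t) f)) := by
    ext ⟨k', t'⟩
    refine (startOp_apply hc U (n + 1) f (m, k') (Occ.split disjoint_diffs
      (union_diffs (hc (by omega)) (hc (by omega))) (t', t))).trans ?_
    refine Eq.trans ?_ (tensorRight_apply _ _ _ (m, k') t').symm
    refine congrArg (fun g : Fock X (c (n + 2)) => U (n + 1) g (m, k')) ?_
    ext q
    refine congrArg f (Subtype.ext ?_)
    -- The two ways of splitting the inputs of `C_1` into three groups agree by associativity of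
    -- multiset addition.
    exact (add_assoc q.1 t'.1 t.1).symm
  rw [h, hV]
  exact (startOp_apply hc U n f (Occ.split Set.disjoint_sdiff_right
    (Set.union_sdiff_cancel (hc (Nat.le_succ n))) (m, s), k) t).symm

/-- The product telescopes: the innermost step turns `U_{n+1} ⊗ I` into `U_n ⊗ I`. At `n = 0` only
the trivial factor `F_X^∅` is removed. -/
theorem prodOp_comp_startOp (U : Dilations X Y c κ) (V : Steps X Y c κ)
    (hV : ∀ n b x, V n (res (sliceR (Equiv.prodAssoc _ (κ (n + 1)) _).symm b) (tensorRight (Occ.split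
        Set.disjoint_sdiff_right (Set.union_sdiff_cancel (hc (Nat.le_succ (n + 1))))) (U (n + 1)) x)) =
        res (sliceR (regroup (Occ.split Set.disjoint_sdiff_right
          (Set.union_sdiff_cancel (hc (Nat.le_succ n)))) (κ n)) b) (U n x)) (n : ℕ) :
    prodOp X Y c hc κ V n ∘L startOp X Y c hc κ U n = U 0 := by
  induction n with
  | zero =>
    ext f p
    refine (startOp_apply hc U 0 f p Occ.vac).trans ?_
    refine congrArg (fun g : Fock X (c 1) => U 0 g p) ?_
    ext q
    exact congrArg f (Subtype.ext (add_zero q.1))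
  | succ n ih =>
    rw [prodOp, ContinuousLinearMap.comp_assoc, stepOp_comp_startOp hc U V n (hV n), ih]

end Sequence

/-! ## Properties of boxes -/

variable [PartialOrder T]

/-- Completely positive families that do not increase the trace and for which tracing out positions
on a larger cut gives no more than the map of the smaller cut. -/
structure IsSubconsistent (Φ : BoxMaps T X Y) : Prop where
  cp : ∀ C, IsCP (Φ C)
  tr_le : ∀ C, IsTraceNonincreasing (Φ C)
  traceOut_le : ∀ (C D : BoundedCut T) (h : (C.1 : Set T) ⊆ D.1) (n : ℕ)
    (ρ : Fin n → Fin n → TC (Occ X (Set.univ : Set T))), BlockNonneg ρ →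
    ∀ b : Fin n → Occ Y (C.1 : Set T),
      (∑ i, ∑ j, ⟪ket (b i), (traceOut h (Φ D (ρ i j))).1 (ket (b j))⟫_ℂ).re ≤
        (∑ i, ∑ j, ⟪ket (b i), (Φ C (ρ i j)).1 (ket (b j))⟫_ℂ).re

theorem IsCausalBox.isSubconsistent {Φ : BoxMaps T X Y} (h : IsCausalBox Φ) :
    IsSubconsistent Φ where
  cp := h.cp
  tr_le C ρ _ := by rw [h.tp C ρ]
  traceOut_le C D hCD n ρ _ b := by simp_rw [h.consistent C D hCD]; exact le_rfl

/-- Let `Ψ` be the dilating box. By its consistency, entries of `Φ^C` are sums over all occupation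
states of `RY` in `D ∖ C`. Entries of `tr_{D∖C} Φ^D` are the same sums restricted to states without
messages on `R`. The omitted terms, combined over `i` and `j`, are nonnegative because `Ψ^D` is
completely positive. -/
theorem IsSubnormalizedCausalBox.isSubconsistent {Φ : BoxMaps T X Y}
    (h : IsSubnormalizedCausalBox Φ) : IsSubconsistent Φ where
  cp := h.cp
  tr_le C ρ hρ := by
    obtain ⟨d, Ψ, hΨ, hΦ⟩ := h.dilation
    rw [hΦ, ← hΨ.tp C ρ]
    exact ((hΨ.cp C).nonneg hρ).tr_conj_res_le _
  traceOut_le C D hCD n ρ hρ b := by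
    obtain ⟨d, Ψ, hΨ, hΦ⟩ := h.dilation
    have h1 : HasSum (fun s => ∑ i, ∑ j, ⟪ket (Occ.split Set.disjoint_sdiff_right
          (Set.union_sdiff_cancel hCD) (b i, s)), (Φ D (ρ i j)).1 (ket (Occ.split
            Set.disjoint_sdiff_right (Set.union_sdiff_cancel hCD) (b j, s)))⟫_ℂ)
        (∑ i, ∑ j, ⟪ket (b i), (traceOut hCD (Φ D (ρ i j))).1 (ket (b j))⟫_ℂ) :=
      hasSum_sum fun i _ => hasSum_sum fun j _ => hasSum_inner_ptrace _ _ _ _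
    have h2 : HasSum (fun s => ∑ i, ∑ j, ⟪ket (Occ.split Set.disjoint_sdiff_right
          (Set.union_sdiff_cancel hCD) (Occ.inr (Fin d) Y _ (b i), s)), (Ψ D (ρ i j)).1
            (ket (Occ.split Set.disjoint_sdiff_right (Set.union_sdiff_cancel hCD)
              (Occ.inr (Fin d) Y _ (b j), s)))⟫_ℂ)
        (∑ i, ∑ j, ⟪ket (b i), (Φ C (ρ i j)).1 (ket (b j))⟫_ℂ) :=
      hasSum_sum fun i _ => hasSum_sum fun j _ => by
        rw [hΦ, projVacuum, inner_conj_res, hΨ.consistent C D hCD]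
        exact hasSum_inner_ptrace _ _ _ _
    refine hasSum_le_inj (Occ.inr (Fin d) Y _) (Occ.inr (Fin d) Y _).injective (fun s _ => ?_)
      (fun s => le_of_eq (congrArg Complex.re ?_)) (Complex.hasSum_re h1) (Complex.hasSum_re h2)
    · exact (Complex.nonneg_iff.1 (hΨ.cp D n ρ hρ _)).1
    · refine Finset.sum_congr rfl fun i _ => Finset.sum_congr rfl fun j _ => ?_
      rw [hΦ, projVacuum, inner_conj_res, Occ.inr_split, Occ.inr_split]

theorem IsSubnormalizedCausalBox.causal {Φ : BoxMaps T X Y} (h : IsSubnormalizedCausalBox Φ) :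
    ∃ χ, IsCausalityFunction χ ∧ RespectsCausality Φ χ := by
  obtain ⟨d, Ψ, hΨ, hΦ⟩ := h.dilation
  obtain ⟨χ, hχ, hr⟩ := hΨ.causal
  refine ⟨χ, hχ, fun C ρ => ?_⟩
  rw [hΦ, hΦ, ← hr]

theorem IsSubconsistent.isCP_onInput {Φ : BoxMaps T X Y} (h : IsSubconsistent Φ)
    (C : BoundedCut T) (P : Set T) : IsCP (onInput Φ C P) := fun n ρ hρ =>
  h.cp C n _ (isCP_conj _ n ρ hρ)

theorem IsSubconsistent.isTraceNonincreasing_onInput {Φ : BoxMaps T X Y} (h : IsSubconsistent Φ)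
    (C : BoundedCut T) (P : Set T) : IsTraceNonincreasing (onInput Φ C P) := fun ρ hρ =>
  (h.tr_le C _ (hρ.conj _)).trans_eq (congrArg Complex.re (tr_conj_ext _ ρ))

/-- The input outside `P` is the vacuum, so reducing it to `χ(C)` from all of `T` or only from `P`
is the same. -/
theorem RespectsCausality.onInput_ketBra {Φ : BoxMaps T X Y} {χ : LowerSet T → LowerSet T}
    (hr : RespectsCausality Φ χ) (C : BoundedCut T) {P : Set T} {P' : LowerSet T} (hP' : P' = χ C.1)
    (h : (P' : Set T) ⊆ P) (x y : L2 (Occ X P)) :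
    onInput Φ C P (ketBra x y) = onInput Φ C P' (traceOut h (ketBra x y)) := by
  subst hP'
  change Φ C (embed _ (ketBra x y)) = Φ C (embed _ _)
  rw [hr, traceOut_embed_ketBra h (Set.subset_univ P)]

/-! ## The steps of the sequence -/

/-- Subconsistency from `C` to `D` handles the outputs, causality at `D` the inputs. -/
theorem IsSubconsistent.exists_step {Φ : BoxMaps T X Y} (hΦ : IsSubconsistent Φ)
    {χ : LowerSet T → LowerSet T} (hr : RespectsCausality Φ χ) (C D : BoundedCut T)
    (E : LowerSet T) (hE : E = χ D.1) (hDC : (D.1 : Set T) ⊆ C.1) (hED : (E : Set T) ⊆ D.1)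
    {κ κ' : Type u} {U : Fock X (D.1 : Set T) →L[ℂ] L2 (Occ Y (C.1 : Set T) × κ)}
    {U' : Fock X (E : Set T) →L[ℂ] L2 (Occ Y (D.1 : Set T) × κ')}
    (hU : IsMinimalStinespring (onInput Φ C D.1) U)
    (hU' : IsMinimalStinespring (onInput Φ D E) U') :
    ∃ V : L2 (κ' × Occ X ((D.1 : Set T) \ E)) →L[ℂ] L2 (Occ Y ((C.1 : Set T) \ D.1) × κ),
      ‖V‖ ≤ 1 ∧
      (∀ b x, V (res (sliceR (Equiv.prodAssoc _ κ' _).symm b) (tensorRight (Occ.split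
          Set.disjoint_sdiff_right (Set.union_sdiff_cancel hED)) U' x)) =
        res (sliceR (regroup (Occ.split Set.disjoint_sdiff_right
          (Set.union_sdiff_cancel hDC)) κ) b) (U x)) ∧
      ((∀ ρ, Φ D ρ = traceOut hDC (Φ C ρ)) → Isometry V) := by
  obtain ⟨V, hV, hVx, hiso⟩ := exists_factor_contraction
    (Occ.split Set.disjoint_sdiff_right (Set.union_sdiff_cancel hED))
    (Occ.split Set.disjoint_sdiff_right (Set.union_sdiff_cancel hDC)) hU hU' fun n x b => by
      have h := hΦ.traceOut_le D C hDC n (fun i j => embed (Set.subset_univ _)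
        (ketBra (x i) (x j))) (isCP_conj _ n _ (blockNonneg_ketBra x)) b
      refine h.trans_eq (congrArg Complex.re ?_)
      refine Finset.sum_congr rfl fun i _ => Finset.sum_congr rfl fun j _ => ?_
      exact congrArg (fun σ => ⟪ket (b i), σ.1 (ket (b j))⟫_ℂ)
        (hr.onInput_ketBra D hE hED (x i) (x j))
  refine ⟨V, hV, hVx, fun h => hiso fun x y => ?_⟩
  exact (h _).symm.trans (hr.onInput_ketBra D hE hED x y)

/-- Strictness is assumed only for nonempty bounded cuts. By monotonicity `χ(∅)` lies in `χ` of a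
principal cut, so it is bounded; were it nonempty, `χ(χ(∅)) ⊊ χ(∅)` would contradict `χ(∅) ⊆
χ(χ(∅))`. -/
theorem IsCausalityFunction.map_bot {χ : LowerSet T → LowerSet T} (hχ : IsCausalityFunction χ)
    (t : T) : χ ⊥ = ⊥ := by
  by_contra h
  have h1 : χ ⊥ ≤ LowerSet.Iic t :=
    (hχ.mono _ _ bot_le).trans (hχ.lt ⟨LowerSet.Iic t, t, le_rfl⟩ fun h0 => by
      have : t ∈ LowerSet.Iic t := le_refl t
      rw [show LowerSet.Iic t = ⊥ from h0] at this
      exact this).le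
  exact (hχ.lt ⟨χ ⊥, t, h1⟩ h).not_ge (hχ.mono _ _ bot_le)

theorem IsCausalityFunction.le {χ : LowerSet T → LowerSet T} (hχ : IsCausalityFunction χ)
    (C : BoundedCut T) : χ C.1 ≤ C.1 := by
  obtain ⟨C, t, ht⟩ := C
  by_cases h : C = ⊥
  · subst h
    exact (hχ.map_bot t).le
  · exact (hχ.lt ⟨C, t, ht⟩ h).le

/-- The bounded cut `χⁿ(C)`. -/
def iterCut {χ : LowerSet T → LowerSet T} (hχ : IsCausalityFunction χ) (C : BoundedCut T) :
    ℕ → BoundedCut T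
  | 0 => C
  | n + 1 => ⟨χ (iterCut hχ C n).1, (iterCut hχ C n).2.imp fun _ h => (hχ.le _).trans h⟩

theorem iterCut_eq {χ : LowerSet T → LowerSet T} (hχ : IsCausalityFunction χ) (C : BoundedCut T)
    (n : ℕ) : (iterCut hχ C n).1 = χ^[n] C.1 := by
  induction n with
  | zero => rfl
  | succ n ih => rw [Function.iterate_succ_apply', ← ih]; rfl

theorem antitone_iterCut {χ : LowerSet T → LowerSet T} (hχ : IsCausalityFunction χ)
    (C : BoundedCut T) : Antitone fun n => ((iterCut hχ C n).1 : Set T) :=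
  antitone_nat_of_succ_le fun n => hχ.le (iterCut hχ C n)

theorem IsSubconsistent.exists_sequenceRepresentation {Φ : BoxMaps T X Y} (hΦ : IsSubconsistent Φ)
    {χ : LowerSet T → LowerSet T} (hχ : IsCausalityFunction χ) (hr : RespectsCausality Φ χ)
    (C : BoundedCut T) : ∃ c : ℕ → BoundedCut T,
      (∀ n, (c n).1 = χ^[n] C.1) ∧
      (∀ n, Disjoint (((c (n + 1)).1 : Set T) \ (c (n + 2)).1)
        (((c n).1 : Set T) \ (c (n + 1)).1)) ∧
      (∃ (κ : ℕ → Type u) (U : Dilations X Y (fun n => ((c n).1 : Set T)) κ),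
        ∀ n, IsMinimalStinespring (onInput Φ (c n) (c (n + 1)).1) (U n)) ∧
      ∀ (κ : ℕ → Type u) (U : Dilations X Y (fun n => ((c n).1 : Set T)) κ),
        (∀ n, IsMinimalStinespring (onInput Φ (c n) (c (n + 1)).1) (U n)) →
        ∃ V : Steps X Y (fun n => ((c n).1 : Set T)) κ,
          (∀ n, ‖V n‖ ≤ 1) ∧
          ((∀ (C D : BoundedCut T) (h : (C.1 : Set T) ⊆ D.1) ρ, Φ C ρ = traceOut h (Φ D ρ)) →
            ∀ n, Isometry (V n)) ∧ IsSequenceRepresentation Φ χ C c κ U V := by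
  have hc := antitone_iterCut hχ C
  refine ⟨iterCut hχ C, iterCut_eq hχ C, fun n => disjoint_diffs, ?_, fun κ U hU => ?_⟩
  · choose κ U hU using fun n => exists_isMinimalStinespring
      (hΦ.isCP_onInput (iterCut hχ C n) ((iterCut hχ C (n + 1)).1 : Set T))
      (hΦ.isTraceNonincreasing_onInput _ _)
    exact ⟨κ, U, hU⟩
  -- Each `V n` depends only on `U n` and `U (n + 1)`, so any choice of dilations works and the
  -- steps are chosen independently.
  · choose V hV hVx hiso using fun n => hΦ.exists_step hr (iterCut hχ C n) (iterCut hχ C (n + 1))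
      (iterCut hχ C (n + 2)).1 rfl (hc (Nat.le_succ n)) (hc (Nat.le_succ (n + 1))) (hU n)
      (hU (n + 1))
    refine ⟨V, hV, fun h n => hiso n (h _ _ _), rfl, fun n => rfl, hc, ?_, hU, fun n _ =>
      (prodOp_comp_startOp hc U V hVx n).symm⟩
    refine Set.eq_empty_of_forall_notMem fun t ht => ?_
    rw [Set.mem_iInter] at ht
    obtain ⟨n, hn⟩ := hχ.finite C t (ht 0)
    rw [← iterCut_eq hχ] at hn
    exact hn (ht n)

end CausalBoxes

end

/-! ### The proposition and its corollary -/

theorem mainTheorem6 {T : Type u} [PartialOrder T] [Countable T] (dX dY : ℕ) :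
    -- causal boxes: the operators of the sequence representation are isometries
    (∀ Φ : BoxMaps T (Fin dX) (Fin dY), IsCausalBox Φ →
      ∀ χ : LowerSet T → LowerSet T, IsCausalityFunction χ → RespectsCausality Φ χ →
      ∀ C : BoundedCut T, ∃ c : ℕ → BoundedCut T,
        (∀ n, (c n).1 = χ^[n] C.1) ∧
        (∀ n, Disjoint (((c (n + 1)).1 : Set T) \ (c (n + 2)).1)
          (((c n).1 : Set T) \ (c (n + 1)).1)) ∧
        (∃ (κ : ℕ → Type u) (U : Dilations (Fin dX) (Fin dY) (fun n => ((c n).1 : Set T)) κ),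
          ∀ n, IsMinimalStinespring (onInput Φ (c n) (c (n + 1)).1) (U n)) ∧
        ∀ (κ : ℕ → Type u) (U : Dilations (Fin dX) (Fin dY) (fun n => ((c n).1 : Set T)) κ),
          (∀ n, IsMinimalStinespring (onInput Φ (c n) (c (n + 1)).1) (U n)) →
          ∃ V : Steps (Fin dX) (Fin dY) (fun n => ((c n).1 : Set T)) κ,
            (∀ n, Isometry (V n)) ∧ IsSequenceRepresentation Φ χ C c κ U V) ∧
    -- subnormalized causal boxes: the operators are contractions
    (∀ Φ : BoxMaps T (Fin dX) (Fin dY), IsSubnormalizedCausalBox Φ →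
      (∃ χ : LowerSet T → LowerSet T, IsCausalityFunction χ ∧ RespectsCausality Φ χ) ∧
      ∀ χ : LowerSet T → LowerSet T, IsCausalityFunction χ → RespectsCausality Φ χ →
      ∀ C : BoundedCut T, ∃ c : ℕ → BoundedCut T,
        (∀ n, (c n).1 = χ^[n] C.1) ∧
        (∀ n, Disjoint (((c (n + 1)).1 : Set T) \ (c (n + 2)).1)
          (((c n).1 : Set T) \ (c (n + 1)).1)) ∧
        (∃ (κ : ℕ → Type u) (U : Dilations (Fin dX) (Fin dY) (fun n => ((c n).1 : Set T)) κ),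
          ∀ n, IsMinimalStinespring (onInput Φ (c n) (c (n + 1)).1) (U n)) ∧
        ∀ (κ : ℕ → Type u) (U : Dilations (Fin dX) (Fin dY) (fun n => ((c n).1 : Set T)) κ),
          (∀ n, IsMinimalStinespring (onInput Φ (c n) (c (n + 1)).1) (U n)) →
          ∃ V : Steps (Fin dX) (Fin dY) (fun n => ((c n).1 : Set T)) κ,
            (∀ n, ‖V n‖ ≤ 1) ∧ IsSequenceRepresentation Φ χ C c κ U V) := by
  refine ⟨fun Φ hΦ χ hχ hr C => ?_, fun Φ hΦ => ⟨hΦ.causal, fun χ hχ hr C => ?_⟩⟩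
  · obtain ⟨c, h1, h2, h3, h4⟩ := hΦ.isSubconsistent.exists_sequenceRepresentation hχ hr C
    refine ⟨c, h1, h2, h3, fun κ U hU => ?_⟩
    obtain ⟨V, -, hiso, hV⟩ := h4 κ U hU
    exact ⟨V, hiso hΦ.consistent, hV⟩
  · obtain ⟨c, h1, h2, h3, h4⟩ := hΦ.isSubconsistent.exists_sequenceRepresentation hχ hr C
    refine ⟨c, h1, h2, h3, fun κ U hU => ?_⟩
    obtain ⟨V, hV, -, hseq⟩ := h4 κ U hU
    exact ⟨V, hV, hseq⟩
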